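/- Let $D,d,s,t$ be positive integers with $D\ge d\ge 10t^2$ and let $\lambda_1,\lambda_2$ be real numbers. A $(n,r,\lambda,t)$-quantum tensor product expander ($t$-qTPE) in dimension $n$, of degree $r\geq 1$ and with second singular value at most $\lambda$, is a family $\{U_i\}_{i=1}^r$ of $n\times n$ unitary matrices such that, for every linear operator $M$ on $(\mathbb C^n)^{\otimes t}$, $$\Bigl\| \frac1r\sum_{i=1}^r U_i^{\otimes t} M (U_i^\dagger)^{\otimes t} - \int_{\mathbb U(n)} U^{\otimes t} M (U^\dagger)^{\otimes t}\,d\mu(U)\Bigr\|_2\le \lambda\,\|M\|_2 ,$$ where $\mu$ is the Haar probability measure on the unitary group $\mathbb U(n)$ and $\|\cdot\|_2$ is the Schatten 2-norm (Hilbert–Schmidt norm). Let $\mathcal G=\{U_i\}_{i=1}^d$ be a $(D,d,\lambda_1,1)$-qTPE and $\mathcal H=\{V_j\}_{j=1}^s$ a $(d,s,\lambda_2,t)$-qTPE. Let $b\mapsto -b$ be either an involution of $[d]=\{1,\dots,d\}$ with $U_{-b}=U_b^{-1}$ for all $b$ (if $\mathcal G$ has one, i.e. is explicitly Hermitian), or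 the identity map of $[d]$. Let $\dot{\mathcal G}$ be the unitary on $\mathbb C^D\otimes\mathbb C^d\cong\mathbb C^{Dd}$ with $$\dot{\mathcal G}(e_a\otimes e_b)=(U_b e_a)\otimes e_{-b},$$ where $e_a$, $e_b$ are the standard basis vectors of $\mathbb C^D$, $\mathbb C^d$. The zigzag product of $\mathcal G$ and $\mathcal H$ is the family of $s^2$ unitaries $$\bigl\{(1_{\mathbb C^D}\otimes V_i)\,\dot{\mathcal G}\,(1_{\mathbb C^D}\otimes V_j)\bigr\}_{i,j\in[s]}$$ on $\mathbb C^{D}\otimes\mathbb C^d$. Then the zigzag product of $\mathcal G$ and $\mathcal H$ is a $(Dd,s^2,\lambda,t)$-qTPE with $$\lambda=\lambda_1+\lambda_2+\lambda_2^2+24\sqrt[4]{\frac{t(t-1)}{d}} .$$ -/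

import Mathlib

open scoped Kronecker

namespace ZigzagTPE

section Haar

variable {n : Type*} [Fintype n] [DecidableEq n]

instance compactSpace_unitaryGroup : CompactSpace (Matrix.unitaryGroup n ℂ) := by
  have hK : IsCompact (Set.univ.pi fun _ : n => Set.univ.pi fun _ : n =>
      Metric.closedBall (0 : ℂ) 1) :=
    isCompact_univ_pi fun _ => isCompact_univ_pi fun _ => isCompact_closedBall _ _
  have hcl : IsClosed (Matrix.unitaryGroup n ℂ : Set (Matrix n n ℂ)) := isClosed_unitary
  refine isCompact_iff_compactSpace.1 (hK.of_isClosed_subset hcl ?_)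
  intro A hA i _ j _
  simpa using entry_norm_bound_of_unitary hA i j

/-- The Borel sigma-algebra of the unitary group. -/
noncomputable instance measurableSpace_unitaryGroup : MeasurableSpace (Matrix.unitaryGroup n ℂ) :=
  borel (Matrix.unitaryGroup n ℂ)

instance borelSpace_unitaryGroup : BorelSpace (Matrix.unitaryGroup n ℂ) := ⟨rfl⟩

end Haar

/-- The Haar probability measure on the unitary group: the Haar measure normalised so that the
whole (compact) group has measure one. -/
noncomputable def haarUnitary (n : Type*) [Fintype n] [DecidableEq n] :
    MeasureTheory.Measure (Matrix.unitaryGroup n ℂ) :=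
  MeasureTheory.Measure.haarMeasure ⊤

/-- The matrix of `A^{⊗t}`, acting on `(ℂⁿ)^{⊗t}`, in the product basis
`e_{i 0} ⊗ ⋯ ⊗ e_{i (t-1)}` that is indexed by the tuples `i : Fin t → n`. -/
def tensorPow {n : Type*} (t : ℕ) (A : Matrix n n ℂ) : Matrix (Fin t → n) (Fin t → n) ℂ :=
  Matrix.of fun i j => ∏ k, A (i k) (j k)

/-- `M ↦ U^{⊗t} M (U†)^{⊗t}`. -/
def tensorConj {n : Type*} [Fintype n] [DecidableEq n] (t : ℕ) (U : Matrix.unitaryGroup n ℂ)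
    (M : Matrix (Fin t → n) (Fin t → n) ℂ) : Matrix (Fin t → n) (Fin t → n) ℂ :=
  tensorPow t (U : Matrix n n ℂ) * M * tensorPow t (U : Matrix n n ℂ).conjTranspose

/-- The expectation of `U^{⊗t} M (U†)^{⊗t}` under a uniformly random member `U` of the family. -/
noncomputable def designAvg {n κ : Type*} [Fintype n] [DecidableEq n] [Fintype κ] (t : ℕ)
    (U : κ → Matrix.unitaryGroup n ℂ) (M : Matrix (Fin t → n) (Fin t → n) ℂ) :
    Matrix (Fin t → n) (Fin t → n) ℂ :=
  (Fintype.card κ : ℂ)⁻¹ • ∑ i, tensorConj t (U i) M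

/-- The expectation of `U^{⊗t} M (U†)^{⊗t}` under a Haar random unitary `U`. The integral is taken
entry by entry. -/
noncomputable def haarAvg {n : Type*} [Fintype n] [DecidableEq n] (t : ℕ)
    (M : Matrix (Fin t → n) (Fin t → n) ℂ) : Matrix (Fin t → n) (Fin t → n) ℂ :=
  Matrix.of fun i j => ∫ U, tensorConj t U M i j ∂(haarUnitary n)

section Norm

attribute [local instance] Matrix.frobeniusNormedAddCommGroup

/-- The Schatten 2-norm (Hilbert–Schmidt, or Frobenius, norm) of a matrix. -/
noncomputable def hsNorm {m : Type*} [Fintype m] (M : Matrix m m ℂ) : ℝ := ‖M‖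

theorem hsNorm_eq {m : Type*} [Fintype m] (M : Matrix m m ℂ) :
    hsNorm M = Real.sqrt (∑ i, ∑ j, ‖M i j‖ ^ 2) := by
  rw [hsNorm, Matrix.frobenius_norm_def, Real.sqrt_eq_rpow]
  simp only [Real.rpow_ofNat]

end Norm

/-- A `(d, s, lam, t)`-quantum tensor product expander: a nonempty family of `s` unitaries in
dimension `d` whose `t`-fold twirl is within `lam`, in the operator norm induced by the
Schatten 2-norm, of the Haar twirl. -/
structure IsQTPE {n κ : Type*} [Fintype n] [DecidableEq n] [Fintype κ] (d s : ℕ) (lam : ℝ) (t : ℕ)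
    (U : κ → Matrix.unitaryGroup n ℂ) : Prop where
  card_dim : Fintype.card n = d
  card_degree : Fintype.card κ = s
  degree_pos : 0 < s
  norm_le : ∀ M : Matrix (Fin t → n) (Fin t → n) ℂ,
    hsNorm (designAvg t U M - haarAvg t M) ≤ lam * hsNorm M

/-- `inv` is an involution of the index set that makes the family `U` explicitly Hermitian:
`U_{-i} = U_i⁻¹`. -/
def IsHermitianInvolution {n κ : Type*} [Fintype n] [DecidableEq n]
    (U : κ → Matrix.unitaryGroup n ℂ) (inv : Equiv.Perm κ) : Prop :=
  Function.Involutive inv ∧ ∀ i, U (inv i) = (U i)⁻¹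

/-- The matrix of `e_a ⊗ e_b ↦ (U_b e_a) ⊗ e_{-b}`, where `-b` is `inv b`. -/
def dotMatrix {n κ : Type*} [Fintype n] [DecidableEq n] [DecidableEq κ]
    (U : κ → Matrix.unitaryGroup n ℂ) (inv : Equiv.Perm κ) : Matrix (n × κ) (n × κ) ℂ :=
  Matrix.of fun x y => if x.2 = inv y.2 then (U y.2 : Matrix n n ℂ) x.1 y.1 else 0

theorem dotMatrix_mem {n κ : Type*} [Fintype n] [DecidableEq n] [Fintype κ] [DecidableEq κ]
    (U : κ → Matrix.unitaryGroup n ℂ) (inv : Equiv.Perm κ) :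
    dotMatrix U inv ∈ Matrix.unitaryGroup (n × κ) ℂ := by
  rw [Matrix.mem_unitaryGroup_iff']
  ext ⟨a, b⟩ ⟨a', b'⟩
  have hU := congrFun (congrFun (Matrix.mem_unitaryGroup_iff'.1 (U b).2) a) a'
  simp only [Matrix.star_eq_conjTranspose, Matrix.mul_apply, Matrix.conjTranspose_apply] at hU
  simp only [Matrix.star_eq_conjTranspose, Matrix.mul_apply, Matrix.conjTranspose_apply, dotMatrix,
    Matrix.of_apply, Fintype.sum_prod_type]
  by_cases h : b = b'
  · subst h
    simpa [Matrix.one_apply] using hU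
  · have h' : ¬ inv b = inv b' := fun e => h (inv.injective e)
    have h1 : (1 : Matrix (n × κ) (n × κ) ℂ) (a, b) (a', b') = 0 := by
      simp [h]
    rw [h1]
    refine Finset.sum_eq_zero fun x _ => Finset.sum_eq_zero fun y _ => ?_
    by_cases e : y = inv b
    · simp [e, h']
    · simp [e]

/-- The members `(1 ⊗ V_i) Ġ (1 ⊗ V_j)` of the zigzag product of `U` (a family of unitaries on
`ℂ^D`, indexed by the basis of `ℂ^d`) with `V` (a family of unitaries on `ℂ^d`), as unitaries on
`ℂ^D ⊗ ℂ^d`; here `Ġ` is `dotMatrix U inv`. -/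
def zigzag {n m κ : Type*} [Fintype n] [DecidableEq n] [Fintype m] [DecidableEq m]
    (U : m → Matrix.unitaryGroup n ℂ) (inv : Equiv.Perm m) (V : κ → Matrix.unitaryGroup m ℂ) :
    κ × κ → Matrix.unitaryGroup (n × m) ℂ := fun p =>
  ⟨((1 : Matrix n n ℂ) ⊗ₖ (V p.1 : Matrix m m ℂ)) * dotMatrix U inv *
      ((1 : Matrix n n ℂ) ⊗ₖ (V p.2 : Matrix m m ℂ)),
    mul_mem (mul_mem (Matrix.kronecker_mem_unitary (one_mem _) (V p.1).2) (dotMatrix_mem U inv))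
      (Matrix.kronecker_mem_unitary (one_mem _) (V p.2).2)⟩

end ZigzagTPE

open scoped Kronecker

namespace ZigzagTPE

/-! ### Hilbert–Schmidt inner product -/

section FrobeniusInner

attribute [local instance] Matrix.frobeniusNormedAddCommGroup Matrix.frobeniusNormedSpace

/-! All operators on `(ℂ^D ⊗ ℂ^d)^{⊗t}` are treated as vectors for the Hilbert–Schmidt inner
product. By invariance of Haar measure, the Haar twirl is the orthogonal projection onto the space
`K` of operators commuting with every `U^{⊗t}` (`haarAvg_eq_starProjection`). The zigzag twirl
factors as `E ∘ G ∘ E`, where `E` averages over `1 ⊗ V_i` and `G` is conjugation by `Ġ^{⊗t}`. Let `Q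
⊇ K` be the operators commuting with all `(1 ⊗ W)^{⊗t}`. Then `E` is the identity on `Q` and
contracts `Qᗮ` by `λ₂`, while `G` is an isometry fixing `K`. The zigzag argument
(`norm_zigzag_sub_starProjection_le`) reduces everything to bounding the compression of `G` to `Q ∩
Kᗮ` by `λ₁ + 5ε`, with `ε = t(t-1)/d`.

Neither Schur–Weyl duality nor Weingarten calculus is needed to describe `Q`: diagonal unitaries and
permutation matrices suffice. In a row labelled by a tuple `b` with distinct entries, only the
blocks at `(b, b ∘ π)` survive, and they depend on `π` alone. Rows with repeated entries carry at
most a fraction `ε` of the squared norm (`sum_not_injective_le`), as a Fourier transform of two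
tensor factors shows.

On the distinct tuples `G` conjugates blocks by `U_{b_1} ⊗ ⋯ ⊗ U_{b_t}`. Summed over all `b`, this
is the `t`-th tensor power of the twirl of `𝒢`, which is within `λ₁`, with no factor `t`, of the
tensor power of the trace projection (`l2_norm_tensorOn_sub_le`). The traces that remain are small
because an element of `Kᗮ` is orthogonal to all permutation operators
(`card_mul_sum_norm_trace_sq_le`). Finally `5ε ≤ 24 ε^{1/4}`. -/

theorem frobenius_norm_sq {m : Type*} [Fintype m] (A : Matrix m m ℂ) :
    ‖A‖ ^ 2 = ∑ i, ∑ j, ‖A i j‖ ^ 2 := by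
  have h := hsNorm_eq A
  rw [hsNorm] at h
  rw [h, Real.sq_sqrt]
  exact Finset.sum_nonneg fun i _ => Finset.sum_nonneg fun j _ => sq_nonneg _

/-- The Hilbert–Schmidt inner product on square matrices. -/
@[reducible] noncomputable def frobeniusInnerProductSpace {m : Type*} [Fintype m] :
    InnerProductSpace ℂ (Matrix m m ℂ) :=
  { (Matrix.frobeniusNormedSpace : NormedSpace ℂ (Matrix m m ℂ)) with
    inner := fun A B => ∑ i, ∑ j, starRingEnd ℂ (A i j) * B i j
    norm_sq_eq_re_inner := fun A => by
      rw [frobenius_norm_sq]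
      simp [Complex.conj_mul', ← Complex.ofReal_pow]
    conj_inner_symm := fun A B => by
      simp [mul_comm]
    add_left := fun A B C => by
      simp [add_mul, Finset.sum_add_distrib]
    smul_left := fun A B r => by
      simp [Finset.mul_sum, mul_assoc] }

attribute [local instance] frobeniusInnerProductSpace

theorem frobenius_inner_def {m : Type*} [Fintype m] (A B : Matrix m m ℂ) :
    inner ℂ A B = ∑ i, ∑ j, starRingEnd ℂ (A i j) * B i j := rfl

theorem frobenius_inner_eq_trace {m : Type*} [Fintype m] (A B : Matrix m m ℂ) :
    inner ℂ A B = (A.conjTranspose * B).trace := by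
  rw [frobenius_inner_def, Finset.sum_comm]
  simp [Matrix.trace, Matrix.mul_apply]

theorem frobenius_inner_mul_mul {m : Type*} [Fintype m] (A B M N : Matrix m m ℂ) :
    inner ℂ (A * M * B) N = inner ℂ M (A.conjTranspose * N * B.conjTranspose) := by
  simp only [frobenius_inner_eq_trace, Matrix.conjTranspose_mul]
  rw [Matrix.mul_assoc, Matrix.trace_mul_comm]
  simp only [Matrix.mul_assoc]

theorem frobenius_norm_unitary_mul {m : Type*} [Fintype m] [DecidableEq m] {A B : Matrix m m ℂ}
    (hA : A.conjTranspose * A = 1) (hB : B * B.conjTranspose = 1) (M : Matrix m m ℂ) :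
    ‖A * M * B‖ = ‖M‖ := by
  have h : (inner ℂ (A * M * B) (A * M * B) : ℂ) = inner ℂ M M := by
    rw [frobenius_inner_mul_mul]
    congr 1
    calc A.conjTranspose * (A * M * B) * B.conjTranspose
        = (A.conjTranspose * A) * M * (B * B.conjTranspose) := by simp only [Matrix.mul_assoc]
      _ = M := by rw [hA, hB, Matrix.one_mul, Matrix.mul_one]
  rw [inner_self_eq_norm_sq_to_K, inner_self_eq_norm_sq_to_K] at h
  have h2 : ‖A * M * B‖ ^ 2 = ‖M‖ ^ 2 := by exact_mod_cast h
  exact (sq_eq_sq₀ (norm_nonneg _) (norm_nonneg _)).1 h2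

end FrobeniusInner

/-! ### Tensor products of matrices in the product basis -/

section TensorProd

variable {ι n : Type*} [Fintype ι]

/-- The matrix of `⨂ k, A k` in the product basis. -/
def tensorProd (A : ι → Matrix n n ℂ) : Matrix (ι → n) (ι → n) ℂ :=
  Matrix.of fun i j => ∏ k, A k (i k) (j k)

theorem tensorPow_eq_tensorProd {t : ℕ} (A : Matrix n n ℂ) :
    tensorPow t A = tensorProd fun _ => A := rfl

theorem tensorProd_apply (A : ι → Matrix n n ℂ) (i j : ι → n) :
    tensorProd A i j = ∏ k, A k (i k) (j k) := rfl

theorem tensorProd_mul [DecidableEq ι] [Fintype n] (A B : ι → Matrix n n ℂ) :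
    tensorProd A * tensorProd B = tensorProd fun k => A k * B k := by
  ext i j
  simp only [Matrix.mul_apply, tensorProd_apply, Finset.prod_univ_sum, Fintype.piFinset_univ,
    Finset.prod_mul_distrib]

theorem tensorProd_conjTranspose (A : ι → Matrix n n ℂ) :
    (tensorProd A).conjTranspose = tensorProd fun k => (A k).conjTranspose := by
  ext i j
  simp [tensorProd_apply, Matrix.conjTranspose_apply]

theorem tensorProd_one [DecidableEq n] :
    tensorProd (fun _ : ι => (1 : Matrix n n ℂ)) = 1 := by
  ext i j
  simp only [tensorProd_apply, Matrix.one_apply, Finset.prod_ite_zero, Finset.prod_const_one,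
    Finset.mem_univ, forall_const, funext_iff]

theorem tensorProd_star_mul_self [DecidableEq ι] [Fintype n] [DecidableEq n]
    (U : ι → Matrix.unitaryGroup n ℂ) :
    (tensorProd fun k => (U k : Matrix n n ℂ)).conjTranspose *
      (tensorProd fun k => (U k : Matrix n n ℂ)) = 1 := by
  rw [tensorProd_conjTranspose, tensorProd_mul, ← tensorProd_one]
  congr 1
  funext k
  exact Matrix.mem_unitaryGroup_iff'.1 (U k).2

theorem tensorProd_mul_star_self [DecidableEq ι] [Fintype n] [DecidableEq n]
    (U : ι → Matrix.unitaryGroup n ℂ) :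
    (tensorProd fun k => (U k : Matrix n n ℂ)) *
      (tensorProd fun k => (U k : Matrix n n ℂ)).conjTranspose = 1 := by
  rw [tensorProd_conjTranspose, tensorProd_mul, ← tensorProd_one]
  congr 1
  funext k
  exact Matrix.mem_unitaryGroup_iff.1 (U k).2

end TensorProd

/-! ### Twirls, and the Haar twirl as an orthogonal projection -/

section TensorConj

attribute [local instance] Matrix.frobeniusNormedAddCommGroup Matrix.frobeniusNormedSpace
  frobeniusInnerProductSpace

variable {n : Type*} [Fintype n] [DecidableEq n] {t : ℕ}

theorem tensorConj_eq (U : Matrix.unitaryGroup n ℂ) (M : Matrix (Fin t → n) (Fin t → n) ℂ) :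
    tensorConj t U M = tensorPow t (U : Matrix n n ℂ) * M *
      (tensorPow t (U : Matrix n n ℂ)).conjTranspose := by
  rw [tensorConj, tensorPow_eq_tensorProd, tensorPow_eq_tensorProd, tensorProd_conjTranspose]

theorem tensorConj_apply (U : Matrix.unitaryGroup n ℂ) (M : Matrix (Fin t → n) (Fin t → n) ℂ)
    (i j : Fin t → n) :
    tensorConj t U M i j = ∑ k, ∑ l, (∏ r, (U : Matrix n n ℂ) (i r) (k r)) * M k l *
      ∏ r, starRingEnd ℂ ((U : Matrix n n ℂ) (j r) (l r)) := by
  rw [tensorConj, Matrix.mul_apply, Finset.sum_comm]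
  refine Finset.sum_congr rfl fun l _ => ?_
  rw [Matrix.mul_apply, Finset.sum_mul]
  rfl

theorem tensorConj_mul (U W : Matrix.unitaryGroup n ℂ) (M : Matrix (Fin t → n) (Fin t → n) ℂ) :
    tensorConj t (U * W) M = tensorConj t U (tensorConj t W M) := by
  have h : tensorPow t ((U * W : Matrix.unitaryGroup n ℂ) : Matrix n n ℂ) =
      tensorPow t (U : Matrix n n ℂ) * tensorPow t (W : Matrix n n ℂ) := by
    simp only [tensorPow_eq_tensorProd, tensorProd_mul]
    rfl
  simp only [tensorConj_eq, h, Matrix.conjTranspose_mul, Matrix.mul_assoc]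

/-- `tensorConj t U` as a linear map. -/
noncomputable def tensorConjₗ (t : ℕ) (U : Matrix.unitaryGroup n ℂ) :
    Matrix (Fin t → n) (Fin t → n) ℂ →ₗ[ℂ] Matrix (Fin t → n) (Fin t → n) ℂ where
  toFun := tensorConj t U
  map_add' M N := by simp [tensorConj, Matrix.mul_add, Matrix.add_mul]
  map_smul' c M := by simp [tensorConj]

theorem tensorConjₗ_apply (U : Matrix.unitaryGroup n ℂ) (M : Matrix (Fin t → n) (Fin t → n) ℂ) :
    tensorConjₗ t U M = tensorConj t U M := rfl

theorem norm_tensorConj (U : Matrix.unitaryGroup n ℂ) (M : Matrix (Fin t → n) (Fin t → n) ℂ) :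
    ‖tensorConj t U M‖ = ‖M‖ := by
  rw [tensorConj_eq]
  refine frobenius_norm_unitary_mul (tensorProd_star_mul_self fun _ => U) ?_ M
  rw [Matrix.conjTranspose_conjTranspose]
  exact tensorProd_star_mul_self fun _ => U

theorem inner_tensorConj (U : Matrix.unitaryGroup n ℂ) (M N : Matrix (Fin t → n) (Fin t → n) ℂ) :
    inner ℂ (tensorConj t U M) (tensorConj t U N) = inner ℂ M N := by
  rw [tensorConj_eq U M, frobenius_inner_mul_mul, tensorConj_eq, Matrix.conjTranspose_conjTranspose]
  congr 1
  have h : (tensorPow t (U : Matrix n n ℂ)).conjTranspose * tensorPow t (U : Matrix n n ℂ) = 1 :=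
    tensorProd_star_mul_self fun _ => U
  calc _ = ((tensorPow t (U : Matrix n n ℂ)).conjTranspose * tensorPow t (U : Matrix n n ℂ)) * N *
        ((tensorPow t (U : Matrix n n ℂ)).conjTranspose * tensorPow t (U : Matrix n n ℂ)) := by
          simp only [Matrix.mul_assoc]
    _ = N := by rw [h, Matrix.one_mul, Matrix.mul_one]

/-- The operators that commute with every `U^{⊗t}`. -/
def invariants (n : Type*) [Fintype n] [DecidableEq n] (t : ℕ) :
    Submodule ℂ (Matrix (Fin t → n) (Fin t → n) ℂ) where
  carrier := {M | ∀ U : Matrix.unitaryGroup n ℂ, tensorConj t U M = M}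
  add_mem' {M N} hM hN U := by
    rw [← tensorConjₗ_apply, map_add, tensorConjₗ_apply, tensorConjₗ_apply, hM, hN]
  zero_mem' U := by rw [← tensorConjₗ_apply, map_zero]
  smul_mem' c M hM U := by rw [← tensorConjₗ_apply, map_smul, tensorConjₗ_apply, hM]

theorem mem_invariants {M : Matrix (Fin t → n) (Fin t → n) ℂ} :
    M ∈ invariants n t ↔ ∀ U : Matrix.unitaryGroup n ℂ, tensorConj t U M = M := Iff.rfl

instance isProbabilityMeasure_haarUnitary :
    MeasureTheory.IsProbabilityMeasure (haarUnitary n) := by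
  refine ⟨?_⟩
  have h := MeasureTheory.Measure.haarMeasure_self
    (K₀ := (⊤ : TopologicalSpace.PositiveCompacts (Matrix.unitaryGroup n ℂ)))
  simpa [haarUnitary] using h

instance isMulLeftInvariant_haarUnitary :
    MeasureTheory.Measure.IsMulLeftInvariant (haarUnitary n) := by
  unfold haarUnitary
  infer_instance

theorem continuous_tensorConj (M : Matrix (Fin t → n) (Fin t → n) ℂ) (i j : Fin t → n) :
    Continuous fun U : Matrix.unitaryGroup n ℂ => tensorConj t U M i j := by
  have h : ∀ a b : n, Continuous fun U : Matrix.unitaryGroup n ℂ => (U : Matrix n n ℂ) a b :=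
    fun a b => continuous_subtype_val.matrix_elem a b
  simp only [tensorConj_apply]
  refine continuous_finsetSum _ fun k _ => continuous_finsetSum _ fun l _ => ?_
  refine ((continuous_finsetProd _ fun r _ => h _ _).mul continuous_const).mul
    (continuous_finsetProd _ fun r _ => Complex.continuous_conj.comp (h _ _))

theorem integrable_tensorConj (M : Matrix (Fin t → n) (Fin t → n) ℂ) (i j : Fin t → n) :
    MeasureTheory.Integrable (fun U => tensorConj t U M i j) (haarUnitary n) :=
  (continuous_tensorConj M i j).integrable_of_hasCompactSupport
    (HasCompactSupport.of_compactSpace _)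

/-- Since the Haar average is an entrywise integral, this is the device for moving a linear
functional under the integral sign. It serves both for entries of a further conjugation and for
inner products. -/
theorem sum_mul_haarAvg (c M : Matrix (Fin t → n) (Fin t → n) ℂ) :
    ∑ i, ∑ j, c i j * haarAvg t M i j =
      ∫ U, ∑ i, ∑ j, c i j * tensorConj t U M i j ∂(haarUnitary n) := by
  rw [MeasureTheory.integral_finsetSum]
  · refine Finset.sum_congr rfl fun i _ => ?_
    rw [MeasureTheory.integral_finsetSum]
    · refine Finset.sum_congr rfl fun j _ => ?_
      rw [MeasureTheory.integral_const_mul]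
      rfl
    · exact fun j _ => (integrable_tensorConj M i j).const_mul _
  · exact fun i _ => MeasureTheory.integrable_finsetSum _ fun j _ =>
      (integrable_tensorConj M i j).const_mul _

/-- Conjugation by `W^{⊗t}` passes under the integral, where left invariance of Haar measure absorbs
it. -/
theorem haarAvg_mem_invariants (M : Matrix (Fin t → n) (Fin t → n) ℂ) :
    haarAvg t M ∈ invariants n t := by
  intro W
  ext i j
  have key : ∀ N : Matrix (Fin t → n) (Fin t → n) ℂ, tensorConj t W N i j =
      ∑ k, ∑ l, ((∏ r, (W : Matrix n n ℂ) (i r) (k r)) *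
        ∏ r, starRingEnd ℂ ((W : Matrix n n ℂ) (j r) (l r))) * N k l := by
    intro N
    rw [tensorConj_apply]
    refine Finset.sum_congr rfl fun k _ => Finset.sum_congr rfl fun l _ => by ring
  refine (key _).trans ((sum_mul_haarAvg (Matrix.of fun k l =>
    (∏ r, (W : Matrix n n ℂ) (i r) (k r)) *
      ∏ r, starRingEnd ℂ ((W : Matrix n n ℂ) (j r) (l r))) M).trans ?_)
  simp only [Matrix.of_apply, ← key, ← tensorConj_mul]
  exact MeasureTheory.integral_mul_left_eq_self (μ := haarUnitary n)
    (fun U => tensorConj t U M i j) W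

theorem inner_haarAvg {Z : Matrix (Fin t → n) (Fin t → n) ℂ} (hZ : Z ∈ invariants n t)
    (M : Matrix (Fin t → n) (Fin t → n) ℂ) : inner ℂ Z (haarAvg t M) = inner ℂ Z M := by
  have h := sum_mul_haarAvg (Z.map (starRingEnd ℂ)) M
  simp only [Matrix.map_apply, ← frobenius_inner_def] at h
  rw [h]
  have h2 : ∀ U : Matrix.unitaryGroup n ℂ, (inner ℂ Z (tensorConj t U M) : ℂ) = inner ℂ Z M := by
    intro U
    conv_lhs => rw [← hZ U]
    exact inner_tensorConj U Z M
  simp only [h2]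
  simp

/-- After this identity no integral is needed: only the subspace of invariants matters. -/
theorem haarAvg_eq_starProjection (M : Matrix (Fin t → n) (Fin t → n) ℂ) :
    haarAvg t M = (invariants n t).starProjection M := by
  symm
  refine Submodule.eq_starProjection_of_mem_of_inner_eq_zero (haarAvg_mem_invariants M) ?_
  intro Z hZ
  rw [← inner_conj_symm, inner_sub_right, inner_haarAvg hZ, sub_self, map_zero]

theorem designAvg_of_mem_invariants {κ : Type*} [Fintype κ] [Nonempty κ]
    (U : κ → Matrix.unitaryGroup n ℂ) {M : Matrix (Fin t → n) (Fin t → n) ℂ}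
    (hM : M ∈ invariants n t) : designAvg t U M = M := by
  unfold designAvg
  simp only [mem_invariants.1 hM, Finset.sum_const, Finset.card_univ]
  rw [← Nat.cast_smul_eq_nsmul ℂ, smul_smul, inv_mul_cancel₀, one_smul]
  exact_mod_cast Fintype.card_ne_zero

/-- The family need not be closed under inverses, so its average need not be self-adjoint. This
identity is the part of self-adjointness that is needed: the average maps the orthogonal complement
of the invariants into itself. -/
theorem inner_designAvg {κ : Type*} [Fintype κ] [Nonempty κ]
    (U : κ → Matrix.unitaryGroup n ℂ) {Z : Matrix (Fin t → n) (Fin t → n) ℂ}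
    (hZ : Z ∈ invariants n t) (M : Matrix (Fin t → n) (Fin t → n) ℂ) :
    inner ℂ Z (designAvg t U M) = inner ℂ Z M := by
  have h2 : ∀ U : Matrix.unitaryGroup n ℂ, (inner ℂ Z (tensorConj t U M) : ℂ) = inner ℂ Z M := by
    intro U
    conv_lhs => rw [← hZ U]
    exact inner_tensorConj U Z M
  rw [designAvg, inner_smul_right, inner_sum]
  simp only [h2, Finset.sum_const, Finset.card_univ, nsmul_eq_mul]
  rw [← mul_assoc, inv_mul_cancel₀, one_mul]
  exact_mod_cast Fintype.card_ne_zero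

end TensorConj

/-! ### Matrix entries of operators commuting with all `U^{⊗t}` -/

section Invariants

attribute [local instance] Matrix.frobeniusNormedAddCommGroup Matrix.frobeniusNormedSpace
  frobeniusInnerProductSpace

variable {m : Type*} [Fintype m] [DecidableEq m] {t : ℕ}

theorem tensorPow_diagonal {n : Type*} [DecidableEq n] (z : n → ℂ) :
    tensorPow t (Matrix.diagonal z) = Matrix.diagonal fun b => ∏ r, z (b r) := by
  ext b c
  simp only [tensorPow, Matrix.of_apply, Matrix.diagonal_apply, Finset.prod_ite_zero,
    Finset.mem_univ, forall_const, funext_iff]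

theorem diagonal_mem_unitaryGroup {z : m → ℂ} (hz : ∀ i, ‖z i‖ = 1) :
    Matrix.diagonal z ∈ Matrix.unitaryGroup m ℂ := by
  rw [Matrix.mem_unitaryGroup_iff, Matrix.star_eq_conjTranspose, Matrix.diagonal_conjTranspose,
    Matrix.diagonal_mul_diagonal, ← Matrix.diagonal_one]
  congr 1
  funext i
  simp [Complex.mul_conj', hz]

/-- An operator that commutes with all `U^{⊗t}` preserves the number of tensor factors in each
basis state. -/
theorem sum_indicator_eq_of_ne_zero {M : Matrix (Fin t → m) (Fin t → m) ℂ}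
    (hM : M ∈ invariants m t) {b b' : Fin t → m} (h : M b b' ≠ 0) (v : m) :
    ∑ r, (if b r = v then 1 else 0) = ∑ r, (if b' r = v then 1 else 0) := by
  -- The test unitary is diagonal, with `ζ` at `v` and `1` elsewhere; it multiplies the entry at
  -- `(b, b')` by `ζ` to the difference of the two counts. Counts lie in `0, …, t`, so a root of
  -- order `t + 1` separates them.
  have hζ := Complex.isPrimitiveRoot_exp (t + 1) (Nat.succ_ne_zero t)
  set ζ := Complex.exp (2 * Real.pi * Complex.I / ((t + 1 : ℕ) : ℂ))
  have hn : ‖ζ‖ = 1 := hζ.norm'_eq_one (Nat.succ_ne_zero t)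
  have hz : ∀ i, ‖(if i = v then ζ else 1)‖ = 1 := by
    intro i
    split_ifs <;> simp [hn]
  have hinv := congrFun (congrFun (hM ⟨_, diagonal_mem_unitaryGroup hz⟩) b) b'
  rw [tensorConj_eq, tensorPow_diagonal, Matrix.diagonal_conjTranspose, Matrix.mul_diagonal,
    Matrix.diagonal_mul] at hinv
  have hp : ∀ c : Fin t → m, ∏ r, (if c r = v then ζ else 1) =
      ζ ^ ∑ r, (if c r = v then 1 else 0) := by
    intro c
    rw [← Finset.prod_pow_eq_pow_sum]
    refine Finset.prod_congr rfl fun r _ => ?_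
    split_ifs <;> simp
  have hlt : ∀ c : Fin t → m, ∑ r, (if c r = v then 1 else 0) < t + 1 := by
    intro c
    refine Nat.lt_succ_of_le ?_
    refine (Finset.sum_le_sum (g := fun _ => 1) fun r _ => ?_).trans (by simp)
    split_ifs <;> simp
  simp only [Pi.star_apply, hp] at hinv
  have hw : ζ ^ (∑ r, if b' r = v then 1 else 0) * star (ζ ^ ∑ r, if b' r = v then 1 else 0) = 1 := by
    rw [RCLike.star_def, Complex.mul_conj', norm_pow, hn]
    simp
  refine hζ.pow_inj (hlt b) (hlt b') ?_
  refine mul_right_cancel₀ h ?_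
  calc _ = (ζ ^ ∑ r, if b r = v then 1 else 0) * M b b' *
        (ζ ^ (∑ r, if b' r = v then 1 else 0) * star (ζ ^ ∑ r, if b' r = v then 1 else 0)) := by
          rw [hw, mul_one]
    _ = _ := by linear_combination (ζ ^ ∑ r, if b' r = v then 1 else 0) * hinv

theorem permMatrix_mem_unitaryGroup (σ : Equiv.Perm m) :
    (Matrix.of fun i j => if i = σ j then (1 : ℂ) else 0) ∈ Matrix.unitaryGroup m ℂ := by
  rw [Matrix.mem_unitaryGroup_iff']
  ext i j
  simp [Matrix.mul_apply, Matrix.one_apply, Matrix.star_apply, eq_comm]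

theorem invariants_apply_perm {M : Matrix (Fin t → m) (Fin t → m) ℂ}
    (hM : M ∈ invariants m t) (σ : Equiv.Perm m) (b b' : Fin t → m) :
    M (σ ∘ b) (σ ∘ b') = M b b' := by
  have hinv := congrFun (congrFun (hM ⟨_, permMatrix_mem_unitaryGroup σ⟩) (σ ∘ b)) (σ ∘ b')
  rw [← hinv, tensorConj_apply]
  simp only [Matrix.of_apply, Function.comp_apply, EmbeddingLike.apply_eq_iff_eq, apply_ite
    (starRingEnd ℂ), map_one, map_zero, Finset.prod_ite_zero, Finset.prod_const_one,
    Finset.mem_univ, forall_const, ← funext_iff]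
  simp

theorem exists_perm_comp_eq {ι n : Type*} [Finite n] {b c : ι → n} (hb : Function.Injective b)
    (hc : Function.Injective c) : ∃ σ : Equiv.Perm n, σ ∘ b = c := by
  classical
  let e : {x // x ∈ Set.range b} ≃ {x // x ∈ Set.range c} :=
    (Equiv.ofInjective b hb).symm.trans (Equiv.ofInjective c hc)
  refine ⟨e.extendSubtype, funext fun i => ?_⟩
  rw [Function.comp_apply, Equiv.extendSubtype_apply_of_mem e (b i) ⟨i, rfl⟩]
  have : (Equiv.ofInjective b hb).symm ⟨b i, ⟨i, rfl⟩⟩ = i :=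
    Equiv.ofInjective_symm_apply hb i
  simp [e, this]

/-- Any two injective tuples differ by a relabelling of the basis, and permutation matrices are
unitary. Away from collisions this takes the place of Schur–Weyl duality. -/
theorem invariants_apply_comp_perm {M : Matrix (Fin t → m) (Fin t → m) ℂ}
    (hM : M ∈ invariants m t) {b c : Fin t → m} (hb : Function.Injective b)
    (hc : Function.Injective c) (π : Equiv.Perm (Fin t)) : M b (b ∘ π) = M c (c ∘ π) := by
  obtain ⟨σ, rfl⟩ := exists_perm_comp_eq hb hc
  rw [Function.comp_assoc, invariants_apply_perm hM]

/-- Both tuples use each basis label equally often, so injectivity of `b` passes to `b'` and the two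
have the same range. -/
theorem exists_comp_perm_of_ne_zero {M : Matrix (Fin t → m) (Fin t → m) ℂ}
    (hM : M ∈ invariants m t) {b b' : Fin t → m} (hb : Function.Injective b) (h : M b b' ≠ 0) :
    ∃ π : Equiv.Perm (Fin t), b' = b ∘ π := by
  have hc := sum_indicator_eq_of_ne_zero hM h
  simp only [Finset.sum_boole, Nat.cast_id] at hc
  have hle : ∀ v, (Finset.univ.filter fun r => b r = v).card ≤ 1 := by
    intro v
    refine Finset.card_le_one.2 fun i hi j hj => hb ?_
    rw [(Finset.mem_filter.1 hi).2, (Finset.mem_filter.1 hj).2]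
  have hb' : Function.Injective b' := by
    intro i j hij
    refine Finset.card_le_one.1 ((hc (b' j)).symm.le.trans (hle (b' j))) i ?_ j ?_ <;> simp [hij]
  have hex : ∀ r, ∃ s, b s = b' r := by
    intro r
    have : 0 < (Finset.univ.filter fun s => b s = b' r).card := by
      rw [hc]
      exact Finset.card_pos.2 ⟨r, by simp⟩
    obtain ⟨s, hs⟩ := Finset.card_pos.1 this
    exact ⟨s, (Finset.mem_filter.1 hs).2⟩
  choose f hf using hex
  have hfi : Function.Injective f := fun i j hij => hb' (by rw [← hf i, ← hf j, hij])
  exact ⟨Equiv.ofBijective f (Finite.injective_iff_bijective.1 hfi), funext fun r => (hf r).symm⟩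

theorem sum_eq_sum_comp_perm {A n : Type*} [AddCommMonoid A] [Fintype n] {b : Fin t → n}
    (hb : Function.Injective b) (f : (Fin t → n) → A)
    (hf : ∀ b', f b' ≠ 0 → ∃ π : Equiv.Perm (Fin t), b' = b ∘ π) :
    ∑ b', f b' = ∑ π : Equiv.Perm (Fin t), f (b ∘ π) := by
  symm
  refine Finset.sum_of_injOn (fun π : Equiv.Perm (Fin t) => b ∘ π) ?_ (by simp) ?_ (by simp)
  · intro π _ σ _ h
    exact Equiv.ext fun i => hb (congrFun h i)
  · intro b' _ hb'
    by_contra h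
    obtain ⟨π, rfl⟩ := hf b' h
    exact hb' ⟨π, by simp, rfl⟩

/-- The discrete Fourier transform: a unitary all of whose entries have the same modulus. -/
theorem exists_flat_unitary (m : Type*) [Fintype m] [DecidableEq m] [Nonempty m] :
    ∃ F : Matrix.unitaryGroup m ℂ, ∀ i j, ‖(F : Matrix m m ℂ) i j‖ ^ 2 = (Fintype.card m : ℝ)⁻¹ := by
  set d := Fintype.card m with hd
  have hd0 : d ≠ 0 := Fintype.card_ne_zero
  let e := Fintype.equivFin m
  have hζ := Complex.isPrimitiveRoot_exp d hd0
  set ζ := Complex.exp (2 * Real.pi * Complex.I / (d : ℂ))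
  have hn : ‖ζ‖ = 1 := hζ.norm'_eq_one hd0
  have hζ0 : ζ ≠ 0 := hζ.ne_zero hd0
  have hsq : ((Real.sqrt d : ℝ) : ℂ) * (Real.sqrt d : ℝ) = d := by
    rw [← Complex.ofReal_mul, Real.mul_self_sqrt (Nat.cast_nonneg d)]
    simp
  have hs0 : ((Real.sqrt d : ℝ) : ℂ) ≠ 0 := by
    intro h
    rw [h, zero_mul] at hsq
    exact hd0 (by exact_mod_cast hsq.symm)
  let F : Matrix m m ℂ := Matrix.of fun i j =>
    ζ ^ ((e i : ℕ) * (e j : ℕ)) / ((Real.sqrt d : ℝ) : ℂ)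
  refine ⟨⟨F, ?_⟩, fun i j => ?_⟩
  · rw [Matrix.mem_unitaryGroup_iff']
    ext i j
    have hconj : starRingEnd ℂ ζ = ζ⁻¹ := by
      rw [Complex.inv_def, Complex.normSq_eq_norm_sq, hn]
      simp
    have h1 : ∀ k, star F i k * F k j = (d : ℂ)⁻¹ * (ζ ^ (e j : ℕ) * (ζ ^ (e i : ℕ))⁻¹) ^ (e k : ℕ) := by
      intro k
      have h2 : star F i k = (ζ ^ ((e k : ℕ) * (e i : ℕ)))⁻¹ / ((Real.sqrt d : ℝ) : ℂ) := by
        simp [F, Matrix.star_apply, hconj]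
      rw [h2, ← hsq, mul_pow, inv_pow, ← pow_mul, ← pow_mul, mul_comm (e i : ℕ), mul_comm (e j : ℕ)]
      simp only [F, Matrix.of_apply]
      field_simp
    rw [Matrix.mul_apply, Finset.sum_congr rfl fun k _ => h1 k, ← Finset.mul_sum,
      e.sum_comp (fun k : Fin d => (ζ ^ (e j : ℕ) * (ζ ^ (e i : ℕ))⁻¹) ^ (k : ℕ)),
      Fin.sum_univ_eq_sum_range (fun k => (ζ ^ (e j : ℕ) * (ζ ^ (e i : ℕ))⁻¹) ^ k)]
    by_cases hij : i = j
    · subst hij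
      simp [mul_inv_cancel₀ (pow_ne_zero _ hζ0), ← hd, hd0]
    · rw [Matrix.one_apply_ne hij]
      have hne : ζ ^ (e j : ℕ) * (ζ ^ (e i : ℕ))⁻¹ ≠ 1 := by
        intro h
        rw [mul_inv_eq_one₀ (pow_ne_zero _ hζ0)] at h
        exact hij (e.injective (Fin.ext (hζ.pow_inj (e j).2 (e i).2 h).symm))
      rw [geom_sum_eq hne, mul_pow, inv_pow, ← pow_mul, ← pow_mul, mul_comm _ d, mul_comm _ d,
        pow_mul, pow_mul, hζ.pow_eq_one]
      simp
  · simp only [F, Matrix.of_apply, norm_div, norm_pow, hn, one_pow]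
    rw [Complex.norm_real, Real.norm_of_nonneg (Real.sqrt_nonneg _), div_pow, one_pow,
      Real.sq_sqrt (Nat.cast_nonneg d), one_div]

end Invariants

/-! ### Invariant operators have little weight on repeated labels -/

section Collision

attribute [local instance] Matrix.frobeniusNormedAddCommGroup Matrix.frobeniusNormedSpace
  frobeniusInnerProductSpace

variable {m : Type*} [Fintype m] [DecidableEq m] {t : ℕ}

/-- The matrix acting as `A` on the tensor factors in `S` and trivially on the others. -/
def tensorOn {ι n : Type*} [Fintype ι] [DecidableEq ι] [DecidableEq n] (S : Finset ι)
    (A : Matrix n n ℂ) : Matrix (ι → n) (ι → n) ℂ :=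
  tensorProd fun r => if r ∈ S then A else 1

theorem tensorOn_apply {ι n : Type*} [Fintype ι] [DecidableEq ι] [DecidableEq n] (S : Finset ι)
    (A : Matrix n n ℂ) (i j : ι → n) :
    tensorOn S A i j = if ∀ r ∉ S, i r = j r then ∏ r ∈ S, A (i r) (j r) else 0 := by
  have h : tensorOn S A i j = (∏ r ∈ S, A (i r) (j r)) * ∏ r ∈ Sᶜ, if i r = j r then 1 else 0 := by
    rw [tensorOn, tensorProd_apply, ← Finset.prod_mul_prod_compl S]
    congr 1
    · exact Finset.prod_congr rfl fun r hr => by rw [if_pos hr]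
    · refine Finset.prod_congr rfl fun r hr => ?_
      rw [if_neg (Finset.mem_compl.1 hr), Matrix.one_apply]
  rw [h, Finset.prod_ite_zero]
  simp

theorem tensorOn_compl_mul {ι n : Type*} [Fintype ι] [DecidableEq ι] [Fintype n] [DecidableEq n]
    (S : Finset ι) (A : Matrix n n ℂ) :
    tensorOn Sᶜ A * tensorOn S A = tensorProd fun _ => A := by
  rw [tensorOn, tensorOn, tensorProd_mul]
  congr 1
  funext r
  by_cases h : r ∈ S <;> simp [h]

theorem tensorOn_conjTranspose_mul {ι n : Type*} [Fintype ι] [DecidableEq ι] [Fintype n]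
    [DecidableEq n] (S : Finset ι) (U : Matrix.unitaryGroup n ℂ) :
    (tensorOn S (U : Matrix n n ℂ)).conjTranspose * tensorOn S (U : Matrix n n ℂ) = 1 := by
  have h : tensorOn S (U : Matrix n n ℂ) =
      tensorProd fun r => ((if r ∈ S then U else 1 : Matrix.unitaryGroup n ℂ) : Matrix n n ℂ) := by
    rw [tensorOn]
    congr 1
    funext r
    split_ifs <;> rfl
  rw [h]
  exact tensorProd_star_mul_self _

/-- The projection onto the basis states whose tensor factors `k` and `l` agree. -/
def collisionProj (m : Type*) [DecidableEq m] {t : ℕ} (k l : Fin t) :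
    Matrix (Fin t → m) (Fin t → m) ℂ :=
  Matrix.diagonal fun b => if b k = b l then 1 else 0

theorem norm_collisionProj_mul_sq (k l : Fin t) (M : Matrix (Fin t → m) (Fin t → m) ℂ) :
    ‖collisionProj m k l * M‖ ^ 2 = ∑ b, if b k = b l then ∑ b', ‖M b b'‖ ^ 2 else 0 := by
  rw [frobenius_norm_sq]
  refine Finset.sum_congr rfl fun b _ => ?_
  simp only [collisionProj, Matrix.diagonal_mul]
  split_ifs <;> simp

theorem collisionProj_mul_tensorOn_compl (k l : Fin t) (A : Matrix m m ℂ) :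
    collisionProj m k l * tensorOn ({k, l} : Finset (Fin t))ᶜ A =
      tensorOn ({k, l} : Finset (Fin t))ᶜ A * collisionProj m k l := by
  ext b c
  simp only [collisionProj, Matrix.diagonal_mul, Matrix.mul_diagonal, tensorOn_apply]
  by_cases h : ∀ r ∉ ({k, l} : Finset (Fin t))ᶜ, b r = c r
  · rw [h k (by simp), h l (by simp), mul_comm]
  · rw [if_neg h]
    simp

/-- Twirling shows that two tensor factors of an invariant operator agree only with small weight:
after a Fourier transform of these two factors, every row has at most two entries that contribute. -/
theorem norm_collisionProj_mul_eq {M : Matrix (Fin t → m) (Fin t → m) ℂ} (hM : M ∈ invariants m t)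
    (k l : Fin t) (U : Matrix.unitaryGroup m ℂ) :
    ‖collisionProj m k l * M‖ =
      ‖collisionProj m k l * (tensorOn {k, l} (U : Matrix m m ℂ) * M)‖ := by
  set P := tensorPow t (U : Matrix m m ℂ) with hP
  have h1 : P.conjTranspose * P = 1 := tensorProd_star_mul_self fun _ => U
  have h2 : P * P.conjTranspose = 1 := tensorProd_mul_star_self fun _ => U
  have hinv : P * M * P.conjTranspose = M := by rw [← tensorConj_eq]; exact hM U
  have hsplit : P = tensorOn ({k, l} : Finset (Fin t))ᶜ (U : Matrix m m ℂ) *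
      tensorOn {k, l} (U : Matrix m m ℂ) := (tensorOn_compl_mul _ _).symm
  calc ‖collisionProj m k l * M‖ = ‖1 * (collisionProj m k l * (P * M)) * P.conjTranspose‖ := by
        conv_lhs => rw [← hinv]
        simp only [Matrix.one_mul, Matrix.mul_assoc]
    _ = ‖collisionProj m k l * (P * M)‖ :=
        frobenius_norm_unitary_mul (by simp) (by simpa using h1) _
    _ = ‖tensorOn ({k, l} : Finset (Fin t))ᶜ (U : Matrix m m ℂ) *
          (collisionProj m k l * (tensorOn {k, l} (U : Matrix m m ℂ) * M)) * 1‖ := by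
        rw [hsplit, Matrix.mul_one, ← Matrix.mul_assoc, ← Matrix.mul_assoc,
          collisionProj_mul_tensorOn_compl]
        simp only [Matrix.mul_assoc]
    _ = _ := frobenius_norm_unitary_mul (tensorOn_conjTranspose_mul _ U) (by simp) _

/-- Cancelling the common labels outside `{k, l}` leaves an equality of two-element multisets. -/
theorem eq_or_eq_comp_swap {n : Type*} [DecidableEq n] {k l : Fin t} (hkl : k ≠ l)
    {c c' : Fin t → n}
    (h : ∀ r ∉ ({k, l} : Finset (Fin t)), c r = c' r)
    (hc : ∀ v, ∑ r, (if c r = v then 1 else 0) = ∑ r, (if c' r = v then 1 else 0)) :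
    c = c' ∨ c = c' ∘ Equiv.swap k l := by
  have hv : ∀ v, (if c k = v then 1 else 0) + (if c l = v then 1 else 0) =
      (if c' k = v then 1 else 0) + (if c' l = v then 1 else 0) := by
    intro v
    have h1 := hc v
    rw [← Finset.sum_add_sum_compl {k, l}, ← Finset.sum_add_sum_compl {k, l} fun r =>
      if c' r = v then 1 else 0, Finset.sum_pair hkl, Finset.sum_pair hkl] at h1
    have h2 : ∑ r ∈ ({k, l} : Finset (Fin t))ᶜ, (if c r = v then 1 else 0) =
        ∑ r ∈ ({k, l} : Finset (Fin t))ᶜ, (if c' r = v then 1 else 0) :=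
      Finset.sum_congr rfl fun r hr => by rw [h r (Finset.mem_compl.1 hr)]
    omega
  have hcase : (c k = c' k ∧ c l = c' l) ∨ (c k = c' l ∧ c l = c' k) := by
    have h1 := hv (c k)
    have h2 := hv (c l)
    have h3 := hv (c' k)
    have h4 := hv (c' l)
    grind
  have hr : ∀ r, r ≠ k → r ≠ l → c r = c' r := fun r h1 h2 => h r (by simp [h1, h2])
  rcases hcase with ⟨h1, h2⟩ | ⟨h1, h2⟩
  · left
    funext r
    by_cases hk : r = k
    · rw [hk, h1]
    by_cases hl : r = l
    · rw [hl, h2]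
    exact hr r hk hl
  · right
    funext r
    by_cases hk : r = k
    · simp [hk, h1]
    by_cases hl : r = l
    · simp [hl, h2]
    rw [Function.comp_apply, Equiv.swap_apply_of_ne_of_ne hk hl, hr r hk hl]

/-- A contributing `c` agrees with `b` outside `{k, l}` and has the label counts of `b'`. That
leaves at most two candidates, so Cauchy–Schwarz costs only a factor `2`. -/
theorem norm_tensorOn_pair_mul_apply_sq_le {M : Matrix (Fin t → m) (Fin t → m) ℂ}
    (hM : M ∈ invariants m t) {k l : Fin t} (hkl : k ≠ l) (A : Matrix m m ℂ) (b b' : Fin t → m) :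
    ‖(tensorOn {k, l} A * M) b b'‖ ^ 2 ≤
      2 * ∑ c, ‖tensorOn {k, l} A b c‖ ^ 2 * ‖M c b'‖ ^ 2 := by
  set T := tensorOn {k, l} A with hT
  set S := Finset.univ.filter fun c => T b c ≠ 0 ∧ M c b' ≠ 0 with hS
  have hcard : S.card ≤ 2 := by
    rcases S.eq_empty_or_nonempty with h | ⟨c₀, hc₀⟩
    · simp [h]
    have hoff : ∀ c ∈ S, ∀ r ∉ ({k, l} : Finset (Fin t)), b r = c r := by
      intro c hc
      by_contra h
      exact (Finset.mem_filter.1 hc).2.1 (by rw [hT, tensorOn_apply, if_neg h])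
    refine (Finset.card_le_card (t := {c₀, c₀ ∘ Equiv.swap k l}) fun c hc => ?_).trans
      Finset.card_le_two
    rw [Finset.mem_insert, Finset.mem_singleton]
    refine eq_or_eq_comp_swap hkl (fun r hr => ?_) fun v => ?_
    · rw [← hoff c hc r hr, hoff c₀ hc₀ r hr]
    · rw [sum_indicator_eq_of_ne_zero hM (Finset.mem_filter.1 hc).2.2,
        sum_indicator_eq_of_ne_zero hM (Finset.mem_filter.1 hc₀).2.2]
  have hsum : (T * M) b b' = ∑ c ∈ S, T b c * M c b' := by
    rw [Matrix.mul_apply]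
    symm
    refine Finset.sum_subset (Finset.subset_univ _) fun c _ hc => ?_
    by_contra h
    exact hc (Finset.mem_filter.2 ⟨Finset.mem_univ _, left_ne_zero_of_mul h,
      right_ne_zero_of_mul h⟩)
  calc ‖(T * M) b b'‖ ^ 2 ≤ (∑ c ∈ S, ‖T b c * M c b'‖) ^ 2 := by
        rw [hsum]
        gcongr
        exact norm_sum_le _ _
    _ ≤ S.card * ∑ c ∈ S, ‖T b c * M c b'‖ ^ 2 := sq_sum_le_card_mul_sum_sq
    _ ≤ 2 * ∑ c, ‖T b c * M c b'‖ ^ 2 := by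
        gcongr
        · exact_mod_cast hcard
        · exact Finset.subset_univ _
    _ = _ := by simp only [norm_mul, mul_pow]

/-- With `d = Fintype.card m`, at most `d` tuples `b` agree with `c` outside `{k, l}` and have `b k
= b l`; flatness gives each of them weight `d⁻²`. -/
theorem sum_norm_tensorOn_pair_sq_le [Nonempty m] {k l : Fin t} (hkl : k ≠ l) {A : Matrix m m ℂ}
    (hA : ∀ i j, ‖A i j‖ ^ 2 = (Fintype.card m : ℝ)⁻¹) (c : Fin t → m) :
    (∑ b : Fin t → m, if b k = b l then ‖tensorOn {k, l} A b c‖ ^ 2 else 0) ≤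
      (Fintype.card m : ℝ)⁻¹ := by
  have h1 : ∀ b : Fin t → m, ‖tensorOn {k, l} A b c‖ ^ 2 =
      if ∀ r ∉ ({k, l} : Finset (Fin t)), b r = c r then ((Fintype.card m : ℝ)⁻¹) ^ 2 else 0 := by
    intro b
    rw [tensorOn_apply]
    split_ifs with h
    · rw [norm_prod, ← Finset.prod_pow, Finset.prod_congr rfl fun r _ => hA _ _,
        Finset.prod_const, Finset.card_pair hkl]
    · simp
  simp only [h1, ← ite_and]
  rw [← Finset.sum_filter, Finset.sum_const, nsmul_eq_mul]
  have hcard : (Finset.univ.filter fun b : Fin t → m =>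
      b k = b l ∧ ∀ r ∉ ({k, l} : Finset (Fin t)), b r = c r).card ≤ Fintype.card m := by
    rw [← Finset.card_univ (α := m)]
    refine (Finset.card_le_card (t := Finset.univ.image fun v : m =>
      Function.update (Function.update c k v) l v) fun b hb => ?_).trans Finset.card_image_le
    obtain ⟨hb1, hb2⟩ := (Finset.mem_filter.1 hb).2
    refine Finset.mem_image.2 ⟨b k, Finset.mem_univ _, funext fun r => ?_⟩
    by_cases hl : r = l
    · subst hl
      simp [hb1]
    by_cases hk : r = k
    · subst hk
      simp [hl]
    simp [hl, hk, hb2 r]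
  have hpos : (0 : ℝ) < Fintype.card m := by exact_mod_cast Fintype.card_pos
  calc _ ≤ (Fintype.card m : ℝ) * ((Fintype.card m : ℝ)⁻¹) ^ 2 := by
        gcongr
    _ = _ := by field_simp

/-- The flat unitary spreads the two factors evenly, so they collide with weight `1/d`. The `2` is
the Cauchy–Schwarz loss over the two contributing terms. -/
theorem norm_collisionProj_mul_sq_le [Nonempty m] {M : Matrix (Fin t → m) (Fin t → m) ℂ}
    (hM : M ∈ invariants m t) {k l : Fin t} (hkl : k ≠ l) :
    ‖collisionProj m k l * M‖ ^ 2 ≤ 2 / (Fintype.card m : ℝ) * ‖M‖ ^ 2 := by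
  obtain ⟨F, hF⟩ := exists_flat_unitary m
  rw [norm_collisionProj_mul_eq hM k l F, norm_collisionProj_mul_sq]
  set T := tensorOn {k, l} (F : Matrix m m ℂ) with hT
  calc (∑ b, if b k = b l then ∑ b', ‖(T * M) b b'‖ ^ 2 else 0)
      ≤ ∑ b : Fin t → m, if b k = b l then
          ∑ b', 2 * ∑ c, ‖T b c‖ ^ 2 * ‖M c b'‖ ^ 2 else 0 := by
        refine Finset.sum_le_sum fun b _ => ?_
        split_ifs
        · exact Finset.sum_le_sum fun b' _ => norm_tensorOn_pair_mul_apply_sq_le hM hkl _ b b'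
        · exact le_rfl
    _ = 2 * ∑ c, (∑ b : Fin t → m, if b k = b l then ‖T b c‖ ^ 2 else 0) *
          ∑ b', ‖M c b'‖ ^ 2 := by
        simp only [Finset.sum_mul]
        rw [Finset.sum_comm, Finset.mul_sum]
        refine Finset.sum_congr rfl fun b _ => ?_
        split_ifs
        · rw [← Finset.mul_sum, Finset.sum_comm]
          simp only [Finset.mul_sum]
        · simp
    _ ≤ 2 * ∑ c, (Fintype.card m : ℝ)⁻¹ * ∑ b', ‖M c b'‖ ^ 2 := by
        gcongr with c _
        exact sum_norm_tensorOn_pair_sq_le hkl hF c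
    _ = _ := by
        rw [← Finset.mul_sum, frobenius_norm_sq]
        ring

open Classical in
/-- Invariant operators have little weight on the basis states with repeated tensor factors. -/
theorem sum_not_injective_le [Nonempty m] {M : Matrix (Fin t → m) (Fin t → m) ℂ}
    (hM : M ∈ invariants m t) :
    ∑ b ∈ Finset.univ.filter (fun b : Fin t → m => ¬ Function.Injective b), ∑ b', ‖M b b'‖ ^ 2 ≤
      (t * (t - 1) / Fintype.card m : ℝ) * ∑ b, ∑ b', ‖M b b'‖ ^ 2 := by
  -- A tuple with a collision is counted by at least two ordered pairs, `(k, l)` and `(l, k)`; this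
  -- cancels the `2` in the bound for a single pair.
  have h1 : ∀ b : Fin t → m, (if ¬ Function.Injective b then 2 * ∑ b', ‖M b b'‖ ^ 2 else 0) ≤
      ∑ p ∈ (Finset.univ : Finset (Fin t)).offDiag,
        if b p.1 = b p.2 then ∑ b', ‖M b b'‖ ^ 2 else 0 := by
    intro b
    have h0 : 0 ≤ ∑ b', ‖M b b'‖ ^ 2 := Finset.sum_nonneg fun _ _ => sq_nonneg _
    by_cases h : Function.Injective b
    swap
    · rw [if_pos h]
      rw [Function.Injective] at h
      push Not at h
      obtain ⟨k, l, hb, hkl⟩ := h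
      have hne : ((k, l) : Fin t × Fin t) ≠ (l, k) := fun e => hkl (Prod.ext_iff.1 e).1
      have := Finset.sum_le_sum_of_subset_of_nonneg (s := {(k, l), (l, k)})
        (t := (Finset.univ : Finset (Fin t)).offDiag)
        (f := fun p => if b p.1 = b p.2 then ∑ b', ‖M b b'‖ ^ 2 else 0) (by
          intro p hp
          rw [Finset.mem_insert, Finset.mem_singleton] at hp
          rcases hp with rfl | rfl <;> simp [hkl, Ne.symm hkl])
        (by
          intro p _ _
          split_ifs
          · exact h0
          · exact le_rfl)
      rw [Finset.sum_pair hne] at this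
      simp only [hb, if_true] at this
      linarith
    · rw [if_neg (not_not.2 h)]
      refine Finset.sum_nonneg fun p _ => ?_
      split_ifs
      · exact h0
      · exact le_rfl
  have h2 := Finset.sum_le_sum fun (b : Fin t → m) (_ : b ∈ Finset.univ) => h1 b
  rw [Finset.sum_comm, ← Finset.sum_filter, ← Finset.mul_sum] at h2
  have h3 : ∀ p ∈ (Finset.univ : Finset (Fin t)).offDiag,
      (∑ b : Fin t → m, if b p.1 = b p.2 then ∑ b', ‖M b b'‖ ^ 2 else 0) ≤
        2 / (Fintype.card m : ℝ) * ∑ b, ∑ b', ‖M b b'‖ ^ 2 := by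
    intro p hp
    rw [← norm_collisionProj_mul_sq, ← frobenius_norm_sq]
    exact norm_collisionProj_mul_sq_le hM (Finset.mem_offDiag.1 hp).2.2
  have h4 := h2.trans (Finset.sum_le_sum h3)
  rw [Finset.sum_const, Finset.offDiag_card, nsmul_eq_mul, Finset.card_univ, Fintype.card_fin,
    Nat.cast_sub (Nat.le_mul_self t), Nat.cast_mul] at h4
  have h5 : (t * (t - 1) / Fintype.card m : ℝ) * ∑ b, ∑ b', ‖M b b'‖ ^ 2 =
      ((t : ℝ) * t - t) * (2 / (Fintype.card m : ℝ) * ∑ b, ∑ b', ‖M b b'‖ ^ 2) / 2 := by ring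
  rw [h5]
  linarith

open Classical in
-- The weight bound applied to the identity operator, all of whose rows have weight one.
theorem card_not_injective_le [Nonempty m] :
    ((Finset.univ.filter (fun b : Fin t → m => ¬ Function.Injective b)).card : ℝ) ≤
      (t * (t - 1) / Fintype.card m : ℝ) * (Fintype.card m : ℝ) ^ t := by
  have h1 : (1 : Matrix (Fin t → m) (Fin t → m) ℂ) ∈ invariants m t := by
    intro U
    rw [tensorConj_eq, Matrix.mul_one]
    exact tensorProd_mul_star_self fun _ => U
  have h := sum_not_injective_le h1
  have h2 : ∀ b : Fin t → m, ∑ b', ‖(1 : Matrix (Fin t → m) (Fin t → m) ℂ) b b'‖ ^ 2 = 1 := by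
    intro b
    rw [Finset.sum_eq_single b]
    · simp
    · intro c _ hc
      simp [Matrix.one_apply_ne hc.symm]
    · simp
  simp only [h2, Finset.sum_const, nsmul_eq_mul, mul_one, Finset.card_univ] at h
  rw [Fintype.card_fun, Fintype.card_fin] at h
  exact_mod_cast h

end Collision

/-! ### Operators on a single tensor factor, and products of approximations -/

section TensorOn

variable {ι n : Type*} [Fintype ι] [DecidableEq ι] [Fintype n] [DecidableEq n]

theorem tensorOn_mul (S : Finset ι) (A B : Matrix n n ℂ) :
    tensorOn S A * tensorOn S B = tensorOn S (A * B) := by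
  rw [tensorOn, tensorOn, tensorOn, tensorProd_mul]
  congr 1
  funext r
  split_ifs <;> simp

theorem tensorOn_conjTranspose {n : Type*} [DecidableEq n] (S : Finset ι) (A : Matrix n n ℂ) :
    (tensorOn S A).conjTranspose = tensorOn S A.conjTranspose := by
  rw [tensorOn, tensorOn, tensorProd_conjTranspose]
  congr 1
  funext r
  split_ifs <;> simp

theorem tensorOn_insert {k : ι} {S : Finset ι} (hk : k ∉ S) (A : Matrix n n ℂ) :
    tensorOn (insert k S) A = tensorOn {k} A * tensorOn S A := by
  rw [tensorOn, tensorOn, tensorOn, tensorProd_mul]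
  congr 1
  funext r
  by_cases h : r = k
  · subst h
    simp [hk]
  · by_cases h2 : r ∈ S <;> simp [h, h2]

theorem tensorOn_singleton_commute {k : ι} {S : Finset ι} (hk : k ∉ S) (A B : Matrix n n ℂ) :
    tensorOn {k} A * tensorOn S B = tensorOn S B * tensorOn {k} A := by
  rw [tensorOn, tensorOn, tensorProd_mul, tensorProd_mul]
  congr 1
  funext r
  by_cases h : r = k
  · subst h
    simp [hk]
  · simp [h]

/-- Acting on a single tensor factor is a star-homomorphism. -/
def tensorOnHom (k : ι) : Matrix n n ℂ →⋆ₙₐ[ℂ] Matrix (ι → n) (ι → n) ℂ where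
  toFun A := tensorOn {k} A
  map_smul' c A := by
    ext i j
    simp [tensorOn_apply]
  map_zero' := by
    ext i j
    simp [tensorOn_apply]
  map_add' A B := by
    ext i j
    simp only [tensorOn_apply, Finset.prod_singleton, Matrix.add_apply]
    split_ifs <;> simp
  map_mul' A B := (tensorOn_mul _ A B).symm
  map_star' A := (tensorOn_conjTranspose _ A).symm

theorem tensorOnHom_apply (k : ι) (A : Matrix n n ℂ) : tensorOnHom k A = tensorOn {k} A := rfl

end TensorOn

/-- If `a` and `p` commute with `b` and `p'`, where `p` is an orthogonal projection absorbing `a`,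
then approximating `a` by `p` and `b` by `p'` does not accumulate errors in the product. -/
theorem norm_mul_sub_mul_apply_le {H : Type*} [NormedAddCommGroup H] [InnerProductSpace ℂ H]
    {a p b p' : H →L[ℂ] H} {lam : ℝ} (hlam : 0 ≤ lam)
    (hsa : ∀ x y, inner ℂ (p x) y = inner ℂ x (p y)) (hpp : p * p = p) (hap : a * p = p)
    (hpa : p * a = p) (hbp : p * b = b * p) (hpp' : p * p' = p' * p)
    (ha : ‖a - p‖ ≤ lam) (hb : ‖b‖ ≤ 1) (hbp' : ‖b - p'‖ ≤ lam) : ‖a * b - p * p'‖ ≤ lam := by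
  refine ContinuousLinearMap.opNorm_le_bound _ hlam fun x => ?_
  set x₀ := p x with hx₀
  set x₁ := x - p x with hx₁
  have hxx : p x₀ = x₀ := by rw [hx₀, ← mul_apply_eq_comp, hpp]
  have hpx₁ : p x₁ = 0 := by rw [hx₁, map_sub, ← hx₀, hxx, sub_self]
  have horth : ∀ u v : H, p u = 0 → p v = v → ‖u + v‖ ^ 2 = ‖u‖ ^ 2 + ‖v‖ ^ 2 := by
    intro u v hu hv
    have : (inner ℂ u v : ℂ) = 0 := by rw [← hv, ← hsa, hu, inner_zero_left]
    have h := norm_add_sq_eq_norm_sq_add_norm_sq_of_inner_eq_zero u v this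
    simpa only [sq] using h
  have hx : ‖x‖ ^ 2 = ‖x₁‖ ^ 2 + ‖x₀‖ ^ 2 := by
    rw [← horth x₁ x₀ hpx₁ hxx, hx₁, sub_add_cancel]
  have hzero : (a - p) (b x₀) = 0 := by
    rw [← hxx, ← mul_apply_eq_comp b p, ← hbp, mul_apply_eq_comp,
      ← mul_apply_eq_comp (a - p) p, sub_mul, hap, hpp, sub_self,
      zero_apply]
  -- The two summands lie in the kernel and in the range of `p`, so they are orthogonal. Pythagoras
  -- then gives the error `lam` instead of the triangle inequality's `2 * lam`.
  have hdec : (a * b - p * p') x = (a - p) (b x₁) + (b - p') x₀ := by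
    have h1 : (b - p') x₀ = p ((b - p') x) := by
      rw [hx₀, ← mul_apply_eq_comp, ← mul_apply_eq_comp, sub_mul, mul_sub,
        hbp, hpp']
    have h2 : (a - p) (b x₁) = (a - p) (b x) := by
      rw [hx₁, map_sub, map_sub, hzero, sub_zero]
    rw [h1, h2]
    simp only [sub_apply, mul_apply_eq_comp, map_sub]
    abel
  have hu : p ((a - p) (b x₁)) = 0 := by
    rw [← mul_apply_eq_comp, mul_sub, hpa, hpp, sub_self,
      zero_apply]
  have hv : p ((b - p') x₀) = (b - p') x₀ := by
    rw [← mul_apply_eq_comp, mul_sub, hbp, hpp', ← sub_mul,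
      mul_apply_eq_comp, hxx]
  have h1 : ‖(a - p) (b x₁)‖ ≤ lam * ‖x₁‖ := by
    refine ((a - p).le_of_opNorm_le ha _).trans ?_
    have := b.le_of_opNorm_le hb x₁
    rw [one_mul] at this
    gcongr
  have h2 : ‖(b - p') x₀‖ ≤ lam * ‖x₀‖ := (b - p').le_of_opNorm_le hbp' _
  refine le_of_sq_le_sq ?_ (by positivity)
  rw [hdec, horth _ _ hu hv, mul_pow, hx, mul_add, ← mul_pow, ← mul_pow]
  gcongr

/-! ### Tensor powers of an operator close to a projection -/

section TensorPowerBound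

open scoped Matrix.Norms.L2Operator

variable {ι n : Type*} [Fintype ι] [DecidableEq ι] [Fintype n] [DecidableEq n]

theorem l2_norm_mul_sub_mul_le {a p b p' : Matrix n n ℂ} {lam : ℝ} (hlam : 0 ≤ lam)
    (hsa : p.conjTranspose = p) (hpp : p * p = p) (hap : a * p = p)
    (hpa : p * a = p) (hbp : p * b = b * p) (hpp' : p * p' = p' * p)
    (ha : ‖a - p‖ ≤ lam) (hb : ‖b‖ ≤ 1) (hbp' : ‖b - p'‖ ≤ lam) : ‖a * b - p * p'‖ ≤ lam := by
  simp only [Matrix.cstar_norm_def, map_sub, map_mul] at *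
  have hsa' : star (Matrix.toEuclideanCLM (n := n) (𝕜 := ℂ) p) =
      Matrix.toEuclideanCLM (n := n) (𝕜 := ℂ) p := by
    rw [← map_star, Matrix.star_eq_conjTranspose, hsa]
  refine norm_mul_sub_mul_apply_le hlam (fun x y => ?_) ?_ ?_ ?_ ?_ ?_ ha hb hbp'
  · conv_rhs => rw [← hsa', ContinuousLinearMap.star_eq_adjoint,
      ContinuousLinearMap.adjoint_inner_right]
  all_goals simp only [← map_mul, hpp, hap, hpa, hbp, hpp']

/-- Telescoping would give an error growing with the number of factors. Adding one factor at a time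
through `l2_norm_mul_sub_mul_le` keeps the error at `lam`. -/
theorem l2_norm_tensorOn_sub_le {A P : Matrix n n ℂ} {lam : ℝ} (hlam : 0 ≤ lam)
    (hsa : P.conjTranspose = P) (hPP : P * P = P) (hAP : A * P = P) (hPA : P * A = P)
    (hA : ‖A‖ ≤ 1) (hAP' : ‖A - P‖ ≤ lam) (S : Finset ι) :
    ‖tensorOn S A‖ ≤ 1 ∧ ‖tensorOn S A - tensorOn S P‖ ≤ lam := by
  -- Star-homomorphisms between C⋆-algebras are contractive.
  have hslot : ∀ (k : ι) (B : Matrix n n ℂ), ‖tensorOn {k} B‖ ≤ ‖B‖ := fun k B => by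
    let := Matrix.instCStarAlgebra (n := n)
    let := Matrix.instCStarAlgebra (n := ι → n)
    exact NonUnitalStarAlgHom.norm_apply_le (tensorOnHom k) B
  induction S using Finset.induction with
  | empty =>
    have h : ∀ B : Matrix n n ℂ, tensorOn (∅ : Finset ι) B = 1 := fun B => by
      simp [tensorOn, tensorProd_one]
    rw [h, h, sub_self, norm_zero]
    refine ⟨?_, hlam⟩
    have h1 : ‖(1 : Matrix (ι → n) (ι → n) ℂ)‖ = ‖(fun _ => 1 : (ι → n) → ℂ)‖ := by
      rw [← Matrix.l2_opNorm_diagonal, Matrix.diagonal_one]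
    rw [h1]
    exact (pi_norm_le_iff_of_nonneg zero_le_one).2 fun _ => by simp
  | insert k S hk ih =>
    rw [tensorOn_insert hk, tensorOn_insert hk]
    refine ⟨?_, ?_⟩
    · refine (norm_mul_le _ _).trans ?_
      exact mul_le_one₀ ((hslot k A).trans hA) (norm_nonneg _) ih.1
    · refine l2_norm_mul_sub_mul_le hlam ?_ ?_ ?_ ?_ ?_ ?_ ?_ ih.1 ih.2
      · rw [tensorOn_conjTranspose, hsa]
      · rw [tensorOn_mul, hPP]
      · rw [tensorOn_mul, hAP]
      · rw [tensorOn_mul, hPA]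
      · exact tensorOn_singleton_commute hk _ _
      · exact tensorOn_singleton_commute hk _ _
      · rw [← tensorOnHom_apply, ← tensorOnHom_apply, ← map_sub]
        exact (hslot k _).trans hAP'

theorem sum_mulVec_sq_le_of_l2_norm_le {A : Matrix n n ℂ} {c : ℝ} (hA : ‖A‖ ≤ c) (x : n → ℂ) :
    ∑ i, ‖A.mulVec x i‖ ^ 2 ≤ c ^ 2 * ∑ i, ‖x i‖ ^ 2 := by
  have h := (Matrix.l2_opNorm_mulVec A (WithLp.toLp 2 x)).trans
    (mul_le_mul_of_nonneg_right hA (norm_nonneg _))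
  have h2 := pow_le_pow_left₀ (norm_nonneg _) h 2
  rw [mul_pow, EuclideanSpace.norm_sq_eq, EuclideanSpace.norm_sq_eq] at h2
  exact h2

theorem l2_norm_le_of_sum_mulVec_sq_le {A : Matrix n n ℂ} {c : ℝ} (hc : 0 ≤ c)
    (hA : ∀ x : n → ℂ, ∑ i, ‖A.mulVec x i‖ ^ 2 ≤ c ^ 2 * ∑ i, ‖x i‖ ^ 2) : ‖A‖ ≤ c := by
  rw [Matrix.cstar_norm_def]
  refine ContinuousLinearMap.opNorm_le_bound _ hc fun x => ?_
  refine le_of_sq_le_sq ?_ (by positivity)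
  rw [mul_pow, EuclideanSpace.norm_sq_eq, EuclideanSpace.norm_sq_eq]
  simpa using hA (WithLp.ofLp x)

/-- Phrased with sums of squares because the operator norm used here and the Hilbert–Schmidt norm
used elsewhere are competing norms on the same matrix type. -/
theorem sum_tensorProd_mulVec_sub_sq_le {A P : Matrix n n ℂ} {lam : ℝ} (hlam : 0 ≤ lam)
    (hsa : P.conjTranspose = P) (hPP : P * P = P) (hAP : A * P = P) (hPA : P * A = P)
    (hA : ∀ x : n → ℂ, ∑ i, ‖A.mulVec x i‖ ^ 2 ≤ ∑ i, ‖x i‖ ^ 2)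
    (hAP' : ∀ x : n → ℂ, ∑ i, ‖A.mulVec x i - P.mulVec x i‖ ^ 2 ≤ lam ^ 2 * ∑ i, ‖x i‖ ^ 2)
    (x : (ι → n) → ℂ) :
    ∑ i, ‖(tensorProd fun _ => A).mulVec x i - (tensorProd fun _ => P).mulVec x i‖ ^ 2 ≤
      lam ^ 2 * ∑ i, ‖x i‖ ^ 2 := by
  have h1 : ‖A‖ ≤ 1 := l2_norm_le_of_sum_mulVec_sq_le zero_le_one fun x => by
    rw [one_pow, one_mul]
    exact hA x
  have h2 : ‖A - P‖ ≤ lam := l2_norm_le_of_sum_mulVec_sq_le hlam fun x => by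
    simpa only [Matrix.sub_mulVec, Pi.sub_apply] using hAP' x
  have h3 : ∀ B : Matrix n n ℂ, tensorOn (Finset.univ : Finset ι) B = tensorProd fun _ => B :=
    fun B => by simp [tensorOn]
  have h := sum_mulVec_sq_le_of_l2_norm_le
    (l2_norm_tensorOn_sub_le hlam hsa hPP hAP hPA h1 h2 (Finset.univ : Finset ι)).2 x
  rw [h3, h3] at h
  simpa only [Matrix.sub_mulVec, Pi.sub_apply] using h

end TensorPowerBound

/-! ### The first-order expander and its tensor power -/

section FirstOrder

attribute [local instance] Matrix.frobeniusNormedAddCommGroup Matrix.frobeniusNormedSpace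
  frobeniusInnerProductSpace

variable {n κ : Type*} [Fintype n] [DecidableEq n] [Fintype κ] {t : ℕ}

theorem frobenius_norm_one_sq {n : Type*} [Fintype n] [DecidableEq n] :
    ‖(1 : Matrix n n ℂ)‖ ^ 2 = Fintype.card n := by
  rw [frobenius_norm_sq]
  have h : ∀ i, ∑ j, ‖(1 : Matrix n n ℂ) i j‖ ^ 2 = 1 := fun i => by
    rw [Finset.sum_eq_single i]
    · simp
    · intro j _ hj
      simp [Matrix.one_apply_ne hj.symm]
    · simp
  simp [h]

/-- The defining inequality at the identity operator, which has positive norm. -/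
theorem IsQTPE.nonneg [Nonempty n] {D d : ℕ} {lam : ℝ} {U : κ → Matrix.unitaryGroup n ℂ}
    (hU : IsQTPE D d lam t U) : 0 ≤ lam := by
  have h := (norm_nonneg _).trans (hU.norm_le 1)
  have h1 : 0 < hsNorm (1 : Matrix (Fin t → n) (Fin t → n) ℂ) := by
    have h2 := frobenius_norm_one_sq (n := Fin t → n)
    have h3 : (0 : ℝ) < Fintype.card (Fin t → n) := by exact_mod_cast Fintype.card_pos
    rw [← h2] at h3
    exact lt_of_le_of_ne (norm_nonneg _) fun h4 => by
      rw [hsNorm] at h4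
      rw [← h4] at h3
      norm_num at h3
  exact nonneg_of_mul_nonneg_left h h1

theorem IsQTPE.nonempty {D d : ℕ} {lam : ℝ} {U : κ → Matrix.unitaryGroup n ℂ}
    (hU : IsQTPE D d lam t U) : Nonempty κ :=
  Fintype.card_pos_iff.1 (by rw [hU.card_degree]; exact hU.degree_pos)

theorem norm_designAvg_le [Nonempty κ] (U : κ → Matrix.unitaryGroup n ℂ)
    (M : Matrix (Fin t → n) (Fin t → n) ℂ) : ‖designAvg t U M‖ ≤ ‖M‖ := by
  rw [designAvg, norm_smul, norm_inv, Complex.norm_natCast]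
  have h : ‖∑ i, tensorConj t (U i) M‖ ≤ Fintype.card κ * ‖M‖ := by
    refine (norm_sum_le _ _).trans ?_
    simp [norm_tensorConj]
  have h0 : (0 : ℝ) < Fintype.card κ := by exact_mod_cast Fintype.card_pos
  rw [inv_mul_le_iff₀ h0]
  exact h

/-- The only operators commuting with all unitaries are the scalars. -/
theorem haarAvg_one_apply [Nonempty n] (M : Matrix (Fin 1 → n) (Fin 1 → n) ℂ) (i j : Fin 1 → n) :
    haarAvg 1 M i j = if i = j then M.trace / Fintype.card n else 0 := by
  set Z := haarAvg 1 M with hZ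
  have hinv : Z ∈ invariants n 1 := haarAvg_mem_invariants M
  -- Tuples of length one are injective and `Fin 1` has only the trivial permutation, so the
  -- description of invariant entries leaves only scalars.
  have hoff : ∀ i j, i ≠ j → Z i j = 0 := by
    intro i j hij
    by_contra h
    obtain ⟨π, rfl⟩ := exists_comp_perm_of_ne_zero hinv (Function.injective_of_subsingleton i) h
    exact hij (by rw [Subsingleton.elim π 1]; rfl)
  have hdiag : ∀ j, Z j j = Z i i := fun j =>
    invariants_apply_comp_perm hinv (Function.injective_of_subsingleton j)
      (Function.injective_of_subsingleton i) 1
  have hone : (1 : Matrix (Fin 1 → n) (Fin 1 → n) ℂ) ∈ invariants n 1 := by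
    intro U
    rw [tensorConj_eq, Matrix.mul_one]
    exact tensorProd_mul_star_self fun _ => U
  have htr : Z.trace = M.trace := by
    have h := inner_haarAvg hone M
    simpa only [frobenius_inner_eq_trace, Matrix.conjTranspose_one, Matrix.one_mul] using h
  split_ifs with h
  · subst h
    rw [← htr, Matrix.trace]
    simp only [Matrix.diag_apply, hdiag]
    have h0 : (Fintype.card n : ℂ) ≠ 0 := by exact_mod_cast Fintype.card_ne_zero
    simp [h0]
  · exact hoff i j h

/-- The superoperator `X ↦ 𝔼 U_b X U_b†`, as a matrix. -/
noncomputable def twirlMatrix (U : κ → Matrix.unitaryGroup n ℂ) : Matrix (n × n) (n × n) ℂ :=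
  Matrix.of fun p q => (Fintype.card κ : ℂ)⁻¹ *
    ∑ b, (U b : Matrix n n ℂ) p.1 q.1 * starRingEnd ℂ ((U b : Matrix n n ℂ) p.2 q.2)

/-- The superoperator `X ↦ (tr X / dim) 1`, as a matrix. -/
noncomputable def traceMatrix (n : Type*) [Fintype n] [DecidableEq n] :
    Matrix (n × n) (n × n) ℂ :=
  Matrix.of fun p q => if p.1 = p.2 then (if q.1 = q.2 then (Fintype.card n : ℂ)⁻¹ else 0) else 0

theorem traceMatrix_conjTranspose : (traceMatrix n).conjTranspose = traceMatrix n := by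
  ext p q
  simp only [Matrix.conjTranspose_apply, traceMatrix, Matrix.of_apply]
  split_ifs <;> simp

theorem traceMatrix_mul_self [Nonempty n] : traceMatrix n * traceMatrix n = traceMatrix n := by
  have h0 : (Fintype.card n : ℂ) ≠ 0 := by exact_mod_cast Fintype.card_ne_zero
  ext p q
  simp only [Matrix.mul_apply, traceMatrix, Matrix.of_apply, Fintype.sum_prod_type]
  split_ifs <;> simp [h0]

theorem twirlMatrix_mul_traceMatrix [Nonempty κ] (U : κ → Matrix.unitaryGroup n ℂ) :
    twirlMatrix U * traceMatrix n = traceMatrix n := by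
  have h0 : (Fintype.card κ : ℂ) ≠ 0 := by exact_mod_cast Fintype.card_ne_zero
  have h : ∀ (b : κ) (i j : n), ∑ k, (U b : Matrix n n ℂ) i k *
      starRingEnd ℂ ((U b : Matrix n n ℂ) j k) = if i = j then 1 else 0 := fun b i j => by
    have := congrFun (congrFun (Matrix.mem_unitaryGroup_iff.1 (U b).2) i) j
    simpa [Matrix.mul_apply, Matrix.one_apply] using this
  ext p q
  simp only [Matrix.mul_apply, twirlMatrix, traceMatrix, Matrix.of_apply, Fintype.sum_prod_type,
    mul_ite, mul_zero, Finset.sum_ite_eq, Finset.mem_univ, if_true]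
  by_cases hq : q.1 = q.2
  · simp only [hq, if_true]
    rw [← Finset.sum_mul, ← Finset.mul_sum, Finset.sum_comm]
    simp only [h]
    split_ifs <;> simp [h0]
  · simp [hq]

theorem traceMatrix_mul_twirlMatrix [Nonempty κ] (U : κ → Matrix.unitaryGroup n ℂ) :
    traceMatrix n * twirlMatrix U = traceMatrix n := by
  have h0 : (Fintype.card κ : ℂ) ≠ 0 := by exact_mod_cast Fintype.card_ne_zero
  have h : ∀ (b : κ) (i j : n), ∑ k, (U b : Matrix n n ℂ) k i *
      starRingEnd ℂ ((U b : Matrix n n ℂ) k j) = if i = j then 1 else 0 := fun b i j => by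
    have := congrFun (congrFun (Matrix.mem_unitaryGroup_iff'.1 (U b).2) j) i
    simpa [Matrix.mul_apply, Matrix.one_apply, mul_comm, eq_comm] using this
  ext p q
  simp only [Matrix.mul_apply, twirlMatrix, traceMatrix, Matrix.of_apply, Fintype.sum_prod_type,
    ite_mul, zero_mul]
  by_cases hp : p.1 = p.2
  · simp only [hp, if_true, Finset.sum_ite_eq, Finset.mem_univ]
    rw [← Finset.mul_sum, ← Finset.mul_sum, Finset.sum_comm]
    simp only [h]
    split_ifs <;> simp [h0]
  · simp [hp]

theorem sum_prod_eq_sum_fin_one {A n : Type*} [Fintype n] [AddCommMonoid A] (f : n → n → A) :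
    ∑ p : n × n, f p.1 p.2 = ∑ i : Fin 1 → n, ∑ j : Fin 1 → n, f (i 0) (j 0) := by
  rw [Fintype.sum_prod_type]
  rw [← (Equiv.funUnique (Fin 1) n).sum_comp]
  refine Finset.sum_congr rfl fun i _ => ?_
  rw [← (Equiv.funUnique (Fin 1) n).sum_comp]
  rfl

theorem designAvg_one_apply (U : κ → Matrix.unitaryGroup n ℂ) (x : n × n → ℂ) (i j : Fin 1 → n) :
    designAvg 1 U (Matrix.of fun i j : Fin 1 → n => x (i 0, j 0)) i j =
      (twirlMatrix U).mulVec x (i 0, j 0) := by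
  simp only [designAvg, Matrix.smul_apply, Matrix.sum_apply, tensorConj_apply, Matrix.mulVec,
    dotProduct, twirlMatrix, Matrix.of_apply, smul_eq_mul]
  rw [sum_prod_eq_sum_fin_one fun k l => (Fintype.card κ : ℂ)⁻¹ *
    (∑ b, (U b : Matrix n n ℂ) (i 0) k * starRingEnd ℂ ((U b : Matrix n n ℂ) (j 0) l)) * x (k, l)]
  simp only [mul_assoc, ← Finset.mul_sum, Finset.sum_mul]
  congr 1
  rw [Finset.sum_comm]
  refine Finset.sum_congr rfl fun k _ => ?_
  rw [Finset.sum_comm]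
  refine Finset.sum_congr rfl fun b _ => ?_
  rw [Finset.mul_sum]
  refine Finset.sum_congr rfl fun l _ => ?_
  simp only [Finset.univ_unique, Fin.default_eq_zero, Finset.prod_singleton]
  ring

theorem haarAvg_one_apply' [Nonempty n] (x : n × n → ℂ) (i j : Fin 1 → n) :
    haarAvg 1 (Matrix.of fun i j : Fin 1 → n => x (i 0, j 0)) i j =
      (traceMatrix n).mulVec x (i 0, j 0) := by
  rw [haarAvg_one_apply]
  simp only [Matrix.mulVec, dotProduct, traceMatrix, Matrix.of_apply, Fintype.sum_prod_type,
    ite_mul, zero_mul, Matrix.trace, Matrix.diag_apply]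
  have hij : i = j ↔ i 0 = j 0 := ⟨fun h => by rw [h], fun h => funext fun k => by
    rw [Subsingleton.elim k 0, h]⟩
  simp only [hij]
  split_ifs with h
  · simp only [Finset.sum_ite_eq, Finset.mem_univ, if_true, ← Finset.mul_sum]
    rw [div_eq_inv_mul]
    congr 1
    rw [← (Equiv.funUnique (Fin 1) n).sum_comp]
    rfl
  · simp

/-- Matrices are vectorised so that superoperators become matrices. The twirl is unital and trace
preserving, so the trace projection absorbs it on both sides, as the tensor power bound requires. -/
theorem IsQTPE.sum_tensorProd_twirl_sub_sq_le [Nonempty n] {D d : ℕ} {lam : ℝ}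
    {U : κ → Matrix.unitaryGroup n ℂ} (hU : IsQTPE D d lam 1 U) (x : (Fin t → n × n) → ℂ) :
    ∑ i, ‖(tensorProd fun _ => twirlMatrix U).mulVec x i -
      (tensorProd fun _ => traceMatrix n).mulVec x i‖ ^ 2 ≤ lam ^ 2 * ∑ i, ‖x i‖ ^ 2 := by
  have := hU.nonempty
  have hnorm : ∀ x : n × n → ℂ, ∑ p, ‖x p‖ ^ 2 =
      ‖(Matrix.of fun i j : Fin 1 → n => x (i 0, j 0))‖ ^ 2 := fun x => by
    rw [frobenius_norm_sq]
    exact sum_prod_eq_sum_fin_one fun i j => ‖x (i, j)‖ ^ 2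
  refine sum_tensorProd_mulVec_sub_sq_le hU.nonneg traceMatrix_conjTranspose
    traceMatrix_mul_self (twirlMatrix_mul_traceMatrix U) (traceMatrix_mul_twirlMatrix U)
    (fun x => ?_) (fun x => ?_) x
  · rw [hnorm x, hnorm]
    have h : (Matrix.of fun i j : Fin 1 → n => (twirlMatrix U).mulVec x (i 0, j 0)) =
        designAvg 1 U (Matrix.of fun i j : Fin 1 → n => x (i 0, j 0)) := by
      ext i j
      rw [designAvg_one_apply, Matrix.of_apply]
    rw [h]
    gcongr
    exact norm_designAvg_le U _
  · rw [hnorm x, hnorm fun p => (twirlMatrix U).mulVec x p - (traceMatrix n).mulVec x p, ← mul_pow]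
    have h : (Matrix.of fun i j : Fin 1 → n => (twirlMatrix U).mulVec x (i 0, j 0) -
          (traceMatrix n).mulVec x (i 0, j 0)) =
        designAvg 1 U (Matrix.of fun i j : Fin 1 → n => x (i 0, j 0)) -
          haarAvg 1 (Matrix.of fun i j : Fin 1 → n => x (i 0, j 0)) := by
      ext i j
      rw [Matrix.sub_apply, designAvg_one_apply, haarAvg_one_apply', Matrix.of_apply]
    rw [h]
    gcongr
    exact hU.norm_le _

/-- `⨂ k, U (b k)`. -/
def tensorFamily {κ : Type*} (U : κ → Matrix.unitaryGroup n ℂ) (b : Fin t → κ) :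
    Matrix (Fin t → n) (Fin t → n) ℂ := tensorProd fun k => (U (b k) : Matrix n n ℂ)

theorem tensorFamily_conj_apply {κ : Type*} (U : κ → Matrix.unitaryGroup n ℂ) (b b' : Fin t → κ)
    (X : Matrix (Fin t → n) (Fin t → n) ℂ) (i j : Fin t → n) :
    (tensorFamily U b * X * (tensorFamily U b').conjTranspose) i j =
      ∑ k, ∑ l, (∏ r, (U (b r) : Matrix n n ℂ) (i r) (k r)) * X k l *
        ∏ r, starRingEnd ℂ ((U (b' r) : Matrix n n ℂ) (j r) (l r)) := by
  rw [Matrix.mul_apply, Finset.sum_comm]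
  refine Finset.sum_congr rfl fun l _ => ?_
  rw [Matrix.mul_apply, Finset.sum_mul]
  simp [tensorFamily, tensorProd_apply, Matrix.conjTranspose_apply]

theorem norm_tensorFamily_conj {κ : Type*} (U : κ → Matrix.unitaryGroup n ℂ) (b b' : Fin t → κ)
    (X : Matrix (Fin t → n) (Fin t → n) ℂ) :
    ‖tensorFamily U b * X * (tensorFamily U b').conjTranspose‖ = ‖X‖ := by
  refine frobenius_norm_unitary_mul (tensorProd_star_mul_self fun k => U (b k)) ?_ X
  rw [Matrix.conjTranspose_conjTranspose]
  exact tensorProd_star_mul_self fun k => U (b' k)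

/-- Expanding a tensor power of an average gives independent indices `b r` in the `t` factors. This
is how a first-order expander controls conjugation by `U_{b_1} ⊗ ⋯ ⊗ U_{b_t}`. -/
theorem tensorProd_twirlMatrix_mulVec (U : κ → Matrix.unitaryGroup n ℂ)
    (X : Matrix (Fin t → n) (Fin t → n) ℂ) (i j : Fin t → n) :
    (tensorProd fun _ => twirlMatrix U).mulVec
        (fun q : Fin t → n × n => X (fun k => (q k).1) fun k => (q k).2) (fun k => (i k, j k)) =
      ((Fintype.card κ : ℂ) ^ t)⁻¹ *
        (∑ b : Fin t → κ, tensorFamily U b * X * (tensorFamily U b).conjTranspose) i j := by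
  simp only [Matrix.sum_apply, tensorFamily_conj_apply, Matrix.mulVec, dotProduct]
  rw [← (Equiv.arrowProdEquivProdArrow (Fin t) (fun _ => n) (fun _ => n)).symm.sum_comp,
    Fintype.sum_prod_type, Finset.sum_comm (s := Finset.univ (α := Fin t → κ)), Finset.mul_sum]
  refine Finset.sum_congr rfl fun k _ => ?_
  rw [Finset.sum_comm (s := Finset.univ (α := Fin t → κ)), Finset.mul_sum]
  refine Finset.sum_congr rfl fun l _ => ?_
  simp only [tensorProd_apply, twirlMatrix, Matrix.of_apply, Finset.prod_mul_distrib,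
    Finset.prod_const, Finset.card_univ, Fintype.card_fin, Finset.prod_univ_sum,
    Fintype.piFinset_univ, inv_pow, mul_assoc, Finset.sum_mul]
  congr 1
  refine Finset.sum_congr rfl fun b _ => ?_
  simp only [Equiv.arrowProdEquivProdArrow, Equiv.coe_fn_symm_mk]
  ring

theorem tensorProd_traceMatrix_mulVec
    (X : Matrix (Fin t → n) (Fin t → n) ℂ) (i j : Fin t → n) :
    (tensorProd fun _ => traceMatrix n).mulVec
        (fun q : Fin t → n × n => X (fun k => (q k).1) fun k => (q k).2) (fun k => (i k, j k)) =
      ((X.trace / (Fintype.card n : ℂ) ^ t) • (1 : Matrix (Fin t → n) (Fin t → n) ℂ)) i j := by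
  simp only [Matrix.mulVec, dotProduct]
  rw [← (Equiv.arrowProdEquivProdArrow (Fin t) (fun _ => n) (fun _ => n)).symm.sum_comp,
    Fintype.sum_prod_type]
  simp only [tensorProd_apply, traceMatrix, Matrix.of_apply, Equiv.arrowProdEquivProdArrow,
    Equiv.coe_fn_symm_mk, Finset.prod_ite_zero, Finset.mem_univ, forall_const, ← funext_iff,
    Finset.prod_const, Finset.card_univ, Fintype.card_fin, Matrix.smul_apply, Matrix.one_apply,
    smul_eq_mul, Matrix.trace, Matrix.diag_apply, ite_mul, zero_mul]
  split_ifs with h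
  · simp only [Finset.sum_ite_eq, Finset.mem_univ, if_true, ← Finset.mul_sum, inv_pow, mul_one]
    rw [div_eq_inv_mul]
  · simp

theorem IsQTPE.norm_sum_tensorFamily_conj_sub_le [Nonempty n] {D d : ℕ} {lam : ℝ}
    {U : κ → Matrix.unitaryGroup n ℂ} (hU : IsQTPE D d lam 1 U)
    (X : Matrix (Fin t → n) (Fin t → n) ℂ) :
    ‖((d : ℂ) ^ t)⁻¹ • (∑ b : Fin t → κ, tensorFamily U b * X * (tensorFamily U b).conjTranspose) -
      (X.trace / (D : ℂ) ^ t) • (1 : Matrix (Fin t → n) (Fin t → n) ℂ)‖ ≤ lam * ‖X‖ := by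
  have h := hU.sum_tensorProd_twirl_sub_sq_le
    (fun q : Fin t → n × n => X (fun k => (q k).1) fun k => (q k).2)
  refine le_of_sq_le_sq ?_ (mul_nonneg hU.nonneg (norm_nonneg _))
  rw [mul_pow, frobenius_norm_sq, frobenius_norm_sq]
  rw [← (Equiv.arrowProdEquivProdArrow (Fin t) (fun _ => n) (fun _ => n)).symm.sum_comp,
    ← (Equiv.arrowProdEquivProdArrow (Fin t) (fun _ => n) (fun _ => n)).symm.sum_comp,
    Fintype.sum_prod_type, Fintype.sum_prod_type] at h
  refine le_trans (le_of_eq ?_) h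
  refine Finset.sum_congr rfl fun i _ => Finset.sum_congr rfl fun j _ => ?_
  rw [← hU.card_degree, ← hU.card_dim, Matrix.sub_apply, ← tensorProd_traceMatrix_mulVec,
    Matrix.smul_apply, smul_eq_mul, ← tensorProd_twirlMatrix_mulVec]
  rfl

/-- The scalar part is kept as a separate trace term, to be made small later by orthogonality. Its
denominator is the Hilbert–Schmidt norm `√(D^t)` of the identity. -/
theorem IsQTPE.norm_inner_sum_tensorFamily_conj_le [Nonempty n] {D d : ℕ} {lam : ℝ}
    {U : κ → Matrix.unitaryGroup n ℂ} (hU : IsQTPE D d lam 1 U)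
    (X Y : Matrix (Fin t → n) (Fin t → n) ℂ) :
    ‖(inner ℂ Y (∑ b : Fin t → κ, tensorFamily U b * X * (tensorFamily U b).conjTranspose) : ℂ)‖ ≤
      (d : ℝ) ^ t * (lam * ‖X‖ * ‖Y‖ + ‖X.trace‖ / Real.sqrt ((D : ℝ) ^ t) * ‖Y‖) := by
  have hd : (0 : ℝ) < d := by exact_mod_cast hU.degree_pos
  have hD : (0 : ℝ) < D := by
    rw [← hU.card_dim]
    exact_mod_cast Fintype.card_pos
  have hdc : (d : ℂ) ^ t ≠ 0 := pow_ne_zero _ (by exact_mod_cast hd.ne')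
  set S := ∑ b : Fin t → κ, tensorFamily U b * X * (tensorFamily U b).conjTranspose with hS
  set I : Matrix (Fin t → n) (Fin t → n) ℂ := 1
  have hI : ‖I‖ = Real.sqrt ((D : ℝ) ^ t) := by
    rw [← Real.sqrt_sq (norm_nonneg I), frobenius_norm_one_sq, Fintype.card_fun, Fintype.card_fin,
      hU.card_dim]
    simp
  have hdec : S = (d : ℂ) ^ t • ((((d : ℂ) ^ t)⁻¹ • S - (X.trace / (D : ℂ) ^ t) • I) +
      (X.trace / (D : ℂ) ^ t) • I) := by
    rw [sub_add_cancel, smul_smul, mul_inv_cancel₀ hdc, one_smul]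
  have hnorm : ‖S‖ ≤ (d : ℝ) ^ t * (lam * ‖X‖ + ‖X.trace‖ / Real.sqrt ((D : ℝ) ^ t)) := by
    rw [hdec, norm_smul, norm_pow, Complex.norm_natCast]
    gcongr
    refine (norm_add_le _ _).trans ?_
    gcongr
    · exact hU.norm_sum_tensorFamily_conj_sub_le X
    · rw [norm_smul, norm_div, norm_pow, Complex.norm_natCast, hI]
      have h1 := Real.mul_self_sqrt (pow_nonneg hD.le t)
      have h2 : 0 < Real.sqrt ((D : ℝ) ^ t) := Real.sqrt_pos.2 (pow_pos hD t)
      refine le_of_eq ?_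
      nth_rewrite 1 [← h1]
      field_simp
  refine (norm_inner_le_norm _ _).trans ?_
  calc ‖Y‖ * ‖S‖ ≤ ‖Y‖ * ((d : ℝ) ^ t * (lam * ‖X‖ + ‖X.trace‖ / Real.sqrt ((D : ℝ) ^ t))) := by
        gcongr
    _ = _ := by ring

end FirstOrder

/-! ### Block decompositions along the two registers -/

section Slices

attribute [local instance] Matrix.frobeniusNormedAddCommGroup Matrix.frobeniusNormedSpace
  frobeniusInnerProductSpace

variable {n m : Type*} {t : ℕ}

/-- The block of an operator on `(ℂⁿ ⊗ ℂᵐ)^{⊗t}` at given basis states of the first register. -/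
def innerSlice (x : Matrix (Fin t → n × m) (Fin t → n × m) ℂ) (a a' : Fin t → n) :
    Matrix (Fin t → m) (Fin t → m) ℂ :=
  Matrix.of fun b b' => x (fun r => (a r, b r)) (fun r => (a' r, b' r))

/-- The block of an operator on `(ℂⁿ ⊗ ℂᵐ)^{⊗t}` at given basis states of the second register. -/
def outerSlice (x : Matrix (Fin t → n × m) (Fin t → n × m) ℂ) (b b' : Fin t → m) :
    Matrix (Fin t → n) (Fin t → n) ℂ :=
  Matrix.of fun a a' => x (fun r => (a r, b r)) (fun r => (a' r, b' r))

/-- The block at `(b, b ∘ π)`, composed with the permutation `π⁻¹` of the tensor factors. -/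
def permSlice (x : Matrix (Fin t → n × m) (Fin t → n × m) ℂ) (b : Fin t → m)
    (π : Equiv.Perm (Fin t)) : Matrix (Fin t → n) (Fin t → n) ℂ :=
  (outerSlice x b (b ∘ π)).submatrix (Equiv.refl _) (π.symm.arrowCongr (Equiv.refl n))

theorem permSlice_apply (x : Matrix (Fin t → n × m) (Fin t → n × m) ℂ) (b : Fin t → m)
    (π : Equiv.Perm (Fin t)) (a a' : Fin t → n) :
    permSlice x b π a a' = x (fun r => (a r, b r)) (fun r => (a' (π r), b (π r))) := rfl

theorem sum_pair {A : Type*} [AddCommMonoid A] [Fintype n] [Fintype m] (f : (Fin t → n × m) → A) :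
    ∑ i, f i = ∑ a : Fin t → n, ∑ b : Fin t → m, f fun r => (a r, b r) := by
  rw [← (Equiv.arrowProdEquivProdArrow (Fin t) (fun _ => n) (fun _ => m)).symm.sum_comp,
    Fintype.sum_prod_type]
  rfl

theorem inner_submatrix {ι κ : Type*} [Fintype ι] [Fintype κ] (e f : ι ≃ κ) (A B : Matrix κ κ ℂ) :
    (inner ℂ (A.submatrix e f) (B.submatrix e f) : ℂ) = inner ℂ A B := by
  simp only [frobenius_inner_def, Matrix.submatrix_apply]
  rw [e.sum_comp fun i => ∑ j, starRingEnd ℂ (A i (f j)) * B i (f j)]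
  exact Finset.sum_congr rfl fun i _ => f.sum_comp fun j => starRingEnd ℂ (A i j) * B i j

theorem norm_submatrix {ι κ : Type*} [Fintype ι] [Fintype κ] (e f : ι ≃ κ) (A : Matrix κ κ ℂ) :
    ‖A.submatrix e f‖ = ‖A‖ := by
  have h := inner_submatrix e f A A
  rw [inner_self_eq_norm_sq_to_K, inner_self_eq_norm_sq_to_K] at h
  have h2 : ‖A.submatrix e f‖ ^ 2 = ‖A‖ ^ 2 := by exact_mod_cast h
  exact (sq_eq_sq₀ (norm_nonneg _) (norm_nonneg _)).1 h2

variable [Fintype n] [Fintype m]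

theorem inner_eq_sum_outerSlice (y x : Matrix (Fin t → n × m) (Fin t → n × m) ℂ) :
    inner ℂ y x = ∑ b, ∑ b', inner ℂ (outerSlice y b b') (outerSlice x b b') := by
  simp only [frobenius_inner_def, sum_pair]
  rw [Finset.sum_comm]
  refine Finset.sum_congr rfl fun b _ => ?_
  exact (Finset.sum_congr rfl fun a _ => Finset.sum_comm).trans Finset.sum_comm

theorem inner_eq_sum_innerSlice (y x : Matrix (Fin t → n × m) (Fin t → n × m) ℂ) :
    inner ℂ y x = ∑ a, ∑ a', inner ℂ (innerSlice y a a') (innerSlice x a a') := by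
  simp only [frobenius_inner_def, sum_pair]
  refine Finset.sum_congr rfl fun a _ => ?_
  rw [Finset.sum_comm]
  rfl

theorem norm_sq_eq_sum_innerSlice (x : Matrix (Fin t → n × m) (Fin t → n × m) ℂ) :
    ‖x‖ ^ 2 = ∑ a, ∑ a', ‖innerSlice x a a'‖ ^ 2 := by
  have h := inner_eq_sum_innerSlice x x
  simp only [inner_self_eq_norm_sq_to_K] at h
  exact_mod_cast h

variable [DecidableEq m]

/-- The operators on `(ℂⁿ ⊗ ℂᵐ)^{⊗t}` that commute with every `(1 ⊗ W)^{⊗t}`. -/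
def innerInvariants (n m : Type*) [Fintype n] [Fintype m] [DecidableEq m] (t : ℕ) :
    Submodule ℂ (Matrix (Fin t → n × m) (Fin t → n × m) ℂ) where
  carrier := {x | ∀ a a', innerSlice x a a' ∈ invariants m t}
  add_mem' hx hy a a' := (invariants m t).add_mem (hx a a') (hy a a')
  zero_mem' _ _ := (invariants m t).zero_mem
  smul_mem' c _ hx a a' := (invariants m t).smul_mem c (hx a a')


theorem outerSlice_perm {n : Type*} {x : Matrix (Fin t → n × m) (Fin t → n × m) ℂ}
    (hx : ∀ a a', innerSlice x a a' ∈ invariants m t) (σ : Equiv.Perm m) (b b' : Fin t → m) :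
    outerSlice x (σ ∘ b) (σ ∘ b') = outerSlice x b b' := by
  ext a a'
  exact invariants_apply_perm (hx a a') σ b b'

theorem permSlice_eq {n : Type*} {x : Matrix (Fin t → n × m) (Fin t → n × m) ℂ}
    (hx : ∀ a a', innerSlice x a a' ∈ invariants m t) {b c : Fin t → m}
    (hb : Function.Injective b) (hc : Function.Injective c) (π : Equiv.Perm (Fin t)) :
    permSlice x b π = permSlice x c π := by
  ext a a'
  exact invariants_apply_comp_perm (hx a fun r => a' (π r)) hb hc π

theorem exists_perm_of_outerSlice_ne_zero {n : Type*}
    {x : Matrix (Fin t → n × m) (Fin t → n × m) ℂ}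
    (hx : ∀ a a', innerSlice x a a' ∈ invariants m t) {b b' : Fin t → m}
    (hb : Function.Injective b) (h : outerSlice x b b' ≠ 0) :
    ∃ π : Equiv.Perm (Fin t), b' = b ∘ π := by
  by_contra hπ
  refine h (Matrix.ext fun a a' => ?_)
  by_contra h2
  exact hπ (exists_comp_perm_of_ne_zero (hx a a') hb h2)

/-- The fraction of basis states of `(ℂᵈ)^{⊗t}` with repeated factors is at most this number. -/
noncomputable def collisionBound (t d : ℕ) : ℝ := t * (t - 1) / d

theorem collisionBound_nonneg (t d : ℕ) : 0 ≤ collisionBound t d := by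
  unfold collisionBound
  rcases t with _ | t
  · simp
  · push_cast
    rw [add_sub_cancel_right]
    positivity

open Classical in
theorem sum_split {n A : Type*} [AddCommMonoid A] {x : Matrix (Fin t → n × m) (Fin t → n × m) ℂ}
    (hx : ∀ a a', innerSlice x a a' ∈ invariants m t) (f : (Fin t → m) → (Fin t → m) → A)
    (hf : ∀ b b', outerSlice x b b' = 0 → f b b' = 0) :
    ∑ b, ∑ b', f b b' =
      ∑ b ∈ Finset.univ.filter Function.Injective, ∑ π : Equiv.Perm (Fin t), f b (b ∘ π) +
        ∑ b ∈ Finset.univ.filter (fun b : Fin t → m => ¬ Function.Injective b), ∑ b', f b b' := by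
  rw [← Finset.sum_filter_add_sum_filter_not Finset.univ Function.Injective]
  congr 1
  refine Finset.sum_congr rfl fun b hb => ?_
  have hb := (Finset.mem_filter.1 hb).2
  exact sum_eq_sum_comp_perm hb (f b) fun b' h =>
    exists_perm_of_outerSlice_ne_zero hx hb fun h0 => h (hf b b' h0)

open Classical in
-- Inner and outer slices arrange the same entries differently, so the collision bound for each
-- inner slice can be summed.
theorem sum_not_injective_outerSlice_le [Nonempty m]
    {x : Matrix (Fin t → n × m) (Fin t → n × m) ℂ} (hx : x ∈ innerInvariants n m t) :
    ∑ b ∈ Finset.univ.filter (fun b : Fin t → m => ¬ Function.Injective b),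
      ∑ b', ‖outerSlice x b b'‖ ^ 2 ≤ collisionBound t (Fintype.card m) * ‖x‖ ^ 2 := by
  have h := fun a a' => sum_not_injective_le (hx a a')
  have h2 : ∀ s : Finset (Fin t → m), ∑ b ∈ s, ∑ b', ‖outerSlice x b b'‖ ^ 2 =
      ∑ a, ∑ a', ∑ b ∈ s, ∑ b', ‖innerSlice x a a' b b'‖ ^ 2 := by
    intro s
    simp only [frobenius_norm_sq]
    calc ∑ b ∈ s, ∑ b', ∑ a, ∑ a', ‖outerSlice x b b' a a'‖ ^ 2
        = ∑ b ∈ s, ∑ a, ∑ b', ∑ a', ‖outerSlice x b b' a a'‖ ^ 2 :=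
          Finset.sum_congr rfl fun b _ => Finset.sum_comm
      _ = ∑ a, ∑ b ∈ s, ∑ b', ∑ a', ‖outerSlice x b b' a a'‖ ^ 2 := Finset.sum_comm
      _ = ∑ a, ∑ b ∈ s, ∑ a', ∑ b', ‖outerSlice x b b' a a'‖ ^ 2 :=
          Finset.sum_congr rfl fun a _ => Finset.sum_congr rfl fun b _ => Finset.sum_comm
      _ = _ := Finset.sum_congr rfl fun a _ => Finset.sum_comm
  rw [h2, norm_sq_eq_sum_innerSlice, Finset.mul_sum]
  refine Finset.sum_le_sum fun a _ => ?_
  rw [Finset.mul_sum]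
  refine Finset.sum_le_sum fun a' _ => ?_
  rw [frobenius_norm_sq]
  exact h a a'

open Classical in
-- Cauchy–Schwarz, with a factor `√ε` from each operator, where `ε` is the collision bound.
-- Restricting the row index alone suffices.
theorem norm_sum_not_injective_le [Nonempty m] {x y : Matrix (Fin t → n × m) (Fin t → n × m) ℂ}
    (hx : x ∈ innerInvariants n m t) (hy : y ∈ innerInvariants n m t)
    (f : (Fin t → m) → (Fin t → m) → ℂ)
    (hf : ∀ b b', ‖f b b'‖ ≤ ‖outerSlice y b b'‖ * ‖outerSlice x b b'‖) :
    ‖∑ b ∈ Finset.univ.filter (fun b : Fin t → m => ¬ Function.Injective b), ∑ b', f b b'‖ ≤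
      collisionBound t (Fintype.card m) * ‖y‖ * ‖x‖ := by
  set N := Finset.univ.filter (fun b : Fin t → m => ¬ Function.Injective b) with hN
  have hx2 := sum_not_injective_outerSlice_le hx
  have hy2 := sum_not_injective_outerSlice_le hy
  rw [← Finset.sum_product'] at hx2 hy2 ⊢
  refine (norm_sum_le _ _).trans ((Finset.sum_le_sum fun p _ => hf p.1 p.2).trans ?_)
  refine (Real.sum_mul_le_sqrt_mul_sqrt _ _ _).trans ?_
  have hε := collisionBound_nonneg t (Fintype.card m)
  calc _ ≤ Real.sqrt (collisionBound t (Fintype.card m) * ‖y‖ ^ 2) *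
        Real.sqrt (collisionBound t (Fintype.card m) * ‖x‖ ^ 2) := by
          gcongr
    _ = collisionBound t (Fintype.card m) * ‖y‖ * ‖x‖ := by
      rw [← Real.sqrt_mul (by positivity), show collisionBound t (Fintype.card m) * ‖y‖ ^ 2 *
        (collisionBound t (Fintype.card m) * ‖x‖ ^ 2) =
          (collisionBound t (Fintype.card m) * ‖y‖ * ‖x‖) ^ 2 by ring,
        Real.sqrt_sq (by positivity)]

open Classical in
-- All injective rows carry the same blocks, so one reference tuple `b₀` stands for all of them.
theorem inner_eq_card_mul_sum_add {x : Matrix (Fin t → n × m) (Fin t → n × m) ℂ}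
    (hx : x ∈ innerInvariants n m t) {y : Matrix (Fin t → n × m) (Fin t → n × m) ℂ}
    (hy : y ∈ innerInvariants n m t) {b₀ : Fin t → m} (hb₀ : Function.Injective b₀) :
    (inner ℂ y x : ℂ) = (Finset.univ.filter (fun b : Fin t → m => Function.Injective b)).card *
        ∑ π : Equiv.Perm (Fin t), inner ℂ (permSlice y b₀ π) (permSlice x b₀ π) +
      ∑ b ∈ Finset.univ.filter (fun b : Fin t → m => ¬ Function.Injective b),
        ∑ b', inner ℂ (outerSlice y b b') (outerSlice x b b') := by
  rw [inner_eq_sum_outerSlice, sum_split hx]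
  · congr 1
    rw [Finset.sum_congr rfl (g := fun _ => ∑ π : Equiv.Perm (Fin t),
      inner ℂ (permSlice y b₀ π) (permSlice x b₀ π)), Finset.sum_const, nsmul_eq_mul]
    intro b hb
    have hb := (Finset.mem_filter.1 hb).2
    refine Finset.sum_congr rfl fun π _ => ?_
    rw [permSlice_eq hx hb₀ hb, permSlice_eq hy hb₀ hb]
    exact (inner_submatrix _ _ _ _).symm
  · intro b b' h
    rw [h, inner_zero_right]

open Classical in
theorem norm_sq_eq_card_mul_sum_add {x : Matrix (Fin t → n × m) (Fin t → n × m) ℂ}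
    (hx : x ∈ innerInvariants n m t) {b₀ : Fin t → m} (hb₀ : Function.Injective b₀) :
    ‖x‖ ^ 2 = (Finset.univ.filter (fun b : Fin t → m => Function.Injective b)).card *
        ∑ π : Equiv.Perm (Fin t), ‖permSlice x b₀ π‖ ^ 2 +
      ∑ b ∈ Finset.univ.filter (fun b : Fin t → m => ¬ Function.Injective b),
        ∑ b', ‖outerSlice x b b'‖ ^ 2 := by
  have h := inner_eq_card_mul_sum_add hx hx hb₀
  simp only [inner_self_eq_norm_sq_to_K] at h
  apply Complex.ofReal_injective
  push_cast
  exact h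

open Classical in
theorem card_mul_sum_norm_permSlice_le {x : Matrix (Fin t → n × m) (Fin t → n × m) ℂ}
    (hx : x ∈ innerInvariants n m t) {b₀ : Fin t → m} (hb₀ : Function.Injective b₀) :
    (Finset.univ.filter (fun b : Fin t → m => Function.Injective b)).card *
      ∑ π : Equiv.Perm (Fin t), ‖permSlice x b₀ π‖ ^ 2 ≤ ‖x‖ ^ 2 := by
  rw [norm_sq_eq_card_mul_sum_add hx hb₀]
  exact le_add_of_nonneg_right (Finset.sum_nonneg fun _ _ => Finset.sum_nonneg fun _ _ =>
    sq_nonneg _)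

open Classical in
theorem norm_sq_le_card_mul_sum_add [Nonempty m] {x : Matrix (Fin t → n × m) (Fin t → n × m) ℂ}
    (hx : x ∈ innerInvariants n m t) {b₀ : Fin t → m} (hb₀ : Function.Injective b₀) :
    ‖x‖ ^ 2 ≤ (Finset.univ.filter (fun b : Fin t → m => Function.Injective b)).card *
      ∑ π : Equiv.Perm (Fin t), ‖permSlice x b₀ π‖ ^ 2 +
        collisionBound t (Fintype.card m) * ‖x‖ ^ 2 := by
  have h2 := norm_sq_eq_card_mul_sum_add hx hb₀
  have h3 := sum_not_injective_outerSlice_le hx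
  linarith

end Slices

/-! ### Compression of the conjugation by `Ġ` -/

section DotEstimate

attribute [local instance] Matrix.frobeniusNormedAddCommGroup Matrix.frobeniusNormedSpace
  frobeniusInnerProductSpace

variable {n m : Type*} [Fintype n] [DecidableEq n] [Fintype m] [DecidableEq m] {t : ℕ}

open Classical in
theorem IsQTPE.norm_sum_injective_conj_le [Nonempty n] {D d : ℕ} {lam : ℝ}
    {U : m → Matrix.unitaryGroup n ℂ} (hU : IsQTPE D d lam 1 U)
    (X Y : Matrix (Fin t → n) (Fin t → n) ℂ) :
    ‖∑ b ∈ Finset.univ.filter (fun b : Fin t → m => Function.Injective b),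
      (inner ℂ Y (tensorFamily U b * X * (tensorFamily U b).conjTranspose) : ℂ)‖ ≤
      (Finset.univ.filter (fun b : Fin t → m => Function.Injective b)).card *
        ((lam + 2 * collisionBound t d) * ‖X‖ * ‖Y‖ +
          ‖X.trace‖ / Real.sqrt ((D : ℝ) ^ t) * ‖Y‖) := by
  have := hU.nonempty
  set f : (Fin t → m) → ℂ := fun b =>
    inner ℂ Y (tensorFamily U b * X * (tensorFamily U b).conjTranspose) with hf
  set ε := collisionBound t d with hε
  set I := Finset.univ.filter (fun b : Fin t → m => Function.Injective b) with hI
  set J := Finset.univ.filter (fun b : Fin t → m => ¬ Function.Injective b) with hJ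
  set B := lam * ‖X‖ * ‖Y‖ + ‖X.trace‖ / Real.sqrt ((D : ℝ) ^ t) * ‖Y‖ with hB
  set N : ℝ := (d : ℝ) ^ t with hN
  have hNpos : 0 < N := pow_pos (by exact_mod_cast hU.degree_pos) t
  have hJcard : (J.card : ℝ) ≤ ε * N := by
    have h := card_not_injective_le (m := m) (t := t)
    rw [hU.card_degree] at h
    convert! h
  have hsum : (I.card : ℝ) + J.card = N := by
    have h := Finset.card_filter_add_card_filter_not (s := (Finset.univ : Finset (Fin t → m)))
      (fun b => Function.Injective b)
    rw [Finset.card_univ, Fintype.card_fun, Fintype.card_fin, hU.card_degree] at h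
    rw [hN, hI, hJ]
    exact_mod_cast h
  have hfle : ∀ b, ‖f b‖ ≤ ‖X‖ * ‖Y‖ := fun b => by
    refine (norm_inner_le_norm _ _).trans ?_
    rw [norm_tensorFamily_conj, mul_comm]
  have hS : ∀ s : Finset (Fin t → m), ‖∑ b ∈ s, f b‖ ≤ s.card * (‖X‖ * ‖Y‖) := fun s => by
    refine (norm_sum_le _ _).trans ((Finset.sum_le_sum fun b _ => hfle b).trans ?_)
    rw [Finset.sum_const, nsmul_eq_mul]
  have hall : ‖∑ b, f b‖ ≤ N * B := by
    have h := hU.norm_inner_sum_tensorFamily_conj_le (t := t) X Y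
    rwa [inner_sum] at h
  have hsplit : ∑ b, f b = ∑ b ∈ I, f b + ∑ b ∈ J, f b :=
    (Finset.sum_filter_add_sum_filter_not _ _ _).symm
  have hid : N * ‖∑ b ∈ I, f b‖ ≤ I.card * (N * B) + J.card * (I.card * (‖X‖ * ‖Y‖)) +
      I.card * (J.card * (‖X‖ * ‖Y‖)) := by
    -- This identity uses `N = |I| + |J|`. Discarding the tuples in `J` directly would leave a bound
    -- proportional to `N`; here every term carries the factor `|I|`, which matches the weight of
    -- the injective blocks in `‖x‖²`.
    have h1 : (N : ℂ) * ∑ b ∈ I, f b = (I.card : ℂ) * ∑ b, f b + (J.card : ℂ) * ∑ b ∈ I, f b -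
        (I.card : ℂ) * ∑ b ∈ J, f b := by
      rw [← hsum, hsplit]
      push_cast
      ring
    have h2 : ‖(N : ℂ) * ∑ b ∈ I, f b‖ = N * ‖∑ b ∈ I, f b‖ := by
      rw [norm_mul, Complex.norm_real, Real.norm_of_nonneg hNpos.le]
    rw [← h2, h1]
    refine (norm_sub_le _ _).trans (add_le_add ((norm_add_le _ _).trans (add_le_add ?_ ?_)) ?_)
    · rw [norm_mul, Complex.norm_natCast]
      gcongr
    · rw [norm_mul, Complex.norm_natCast]
      gcongr
      exact hS I
    · rw [norm_mul, Complex.norm_natCast]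
      gcongr
      exact hS J
  refine le_of_mul_le_mul_left (hid.trans ?_) hNpos
  have h3 : (J.card : ℝ) * (I.card * (‖X‖ * ‖Y‖)) ≤ ε * N * (I.card * (‖X‖ * ‖Y‖)) := by
    gcongr
  rw [hB]
  nlinarith [h3]

/-- The permutation `π` of the tensor factors. -/
def permOp (n : Type*) [DecidableEq n] {t : ℕ} (π : Equiv.Perm (Fin t)) :
    Matrix (Fin t → n) (Fin t → n) ℂ :=
  Matrix.of fun i j => if j = i ∘ π then 1 else 0

theorem permOp_mem_invariants (π : Equiv.Perm (Fin t)) : permOp n π ∈ invariants n t := by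
  intro U
  set T := tensorPow t (U : Matrix n n ℂ) with hT
  have hcomm : T * permOp n π = permOp n π * T := by
    ext i j
    have h : ∀ k : Fin t → n, j = k ∘ π ↔ k = j ∘ π.symm := fun k =>
      ⟨fun h => by rw [h]; funext r; simp, fun h => by rw [h]; funext r; simp⟩
    simp only [Matrix.mul_apply, permOp, Matrix.of_apply, h, mul_ite, mul_one, mul_zero, ite_mul,
      one_mul, zero_mul, Finset.sum_ite_eq', Finset.mem_univ, if_true]
    rw [hT, tensorPow, Matrix.of_apply, Matrix.of_apply]
    rw [← Equiv.prod_comp π]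
    simp
  rw [tensorConj_eq, hcomm, Matrix.mul_assoc,
    show T * T.conjTranspose = 1 from tensorProd_mul_star_self fun _ => U, Matrix.mul_one]

/-- `1 ⊗ W`. -/
def innerUnitary (n : Type*) [Fintype n] [DecidableEq n] (W : Matrix.unitaryGroup m ℂ) :
    Matrix.unitaryGroup (n × m) ℂ :=
  ⟨(1 : Matrix n n ℂ) ⊗ₖ (W : Matrix m m ℂ), Matrix.kronecker_mem_unitary (one_mem _) W.2⟩

theorem innerSlice_tensorConj_innerUnitary (W : Matrix.unitaryGroup m ℂ)
    (x : Matrix (Fin t → n × m) (Fin t → n × m) ℂ) (a a' : Fin t → n) :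
    innerSlice (tensorConj t (innerUnitary n W) x) a a' = tensorConj t W (innerSlice x a a') := by
  ext b b'
  have h1 : ∀ (a α : Fin t → n) (b β : Fin t → m),
      ∏ r, (innerUnitary n W : Matrix (n × m) (n × m) ℂ) (a r, b r) (α r, β r) =
        if a = α then ∏ r, (W : Matrix m m ℂ) (b r) (β r) else 0 := fun a α b β => by
    simp only [innerUnitary, Matrix.kroneckerMap_apply, Matrix.one_apply, ite_mul, one_mul,
      zero_mul, Finset.prod_ite_zero, Finset.mem_univ, forall_const, funext_iff]
  rw [tensorConj_apply, innerSlice, Matrix.of_apply, tensorConj_apply]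
  simp only [sum_pair, ← map_prod, h1, innerSlice, Matrix.of_apply]
  rw [Finset.sum_eq_single a]
  · refine Finset.sum_congr rfl fun β _ => ?_
    rw [Finset.sum_eq_single a']
    · simp
    · intro α' _ h
      simp [h.symm]
    · simp
  · intro α _ h
    simp [h.symm]
  · simp

theorem invariants_le_innerInvariants : invariants (n × m) t ≤ innerInvariants n m t := by
  intro x hx a a' W
  rw [← innerSlice_tensorConj_innerUnitary, hx]

/-- Injectivity of `b₀` lets the second register identify the permutation, so the operators for `σ ≠
π` vanish on this block. -/
theorem permSlice_sum_permOp {n m : Type*} [DecidableEq n] [DecidableEq m]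
    (c : Equiv.Perm (Fin t) → ℂ) {b₀ : Fin t → m}
    (hb₀ : Function.Injective b₀) (π : Equiv.Perm (Fin t)) :
    permSlice (∑ σ, c σ • permOp (n × m) σ) b₀ π = c π • (1 : Matrix (Fin t → n) (Fin t → n) ℂ) := by
  ext a a'
  rw [permSlice_apply, Matrix.sum_apply, Finset.sum_eq_single π]
  · have h : ((fun r => (a' (π r), b₀ (π r))) = (fun r => (a r, b₀ r)) ∘ π) ↔ a = a' := by
      constructor
      · intro h
        funext r
        have h2 := congrFun h (π.symm r)
        simp only [Function.comp_apply, Equiv.apply_symm_apply, Prod.mk.injEq] at h2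
        exact h2.1.symm
      · rintro rfl
        rfl
    simp only [Matrix.smul_apply, permOp, Matrix.of_apply, h, Matrix.one_apply]
  · intro σ _ hσ
    have h : ¬ ((fun r => (a' (π r), b₀ (π r))) = (fun r => (a r, b₀ r)) ∘ σ) := by
      intro h
      refine hσ (Equiv.ext fun r => hb₀ ?_)
      have h2 := congrFun h r
      simp only [Function.comp_apply, Prod.mk.injEq] at h2
      exact h2.2.symm
    simp [permOp, h]
  · simp

open Classical in
/-- An operator orthogonal to all permutations has blocks of small trace. -/
theorem card_mul_sum_norm_trace_sq_le [Nonempty m] {D d : ℕ} (hD : Fintype.card n = D)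
    (hd : Fintype.card m = d) (hε : collisionBound t d ≤ 1 / 2)
    {x : Matrix (Fin t → n × m) (Fin t → n × m) ℂ} (hx : x ∈ innerInvariants n m t)
    (hx2 : x ∈ (invariants (n × m) t)ᗮ) {b₀ : Fin t → m} (hb₀ : Function.Injective b₀) :
    (Finset.univ.filter (fun b : Fin t → m => Function.Injective b)).card *
      ∑ π : Equiv.Perm (Fin t), ‖(permSlice x b₀ π).trace‖ ^ 2 ≤
        (2 * collisionBound t d * Real.sqrt ((D : ℝ) ^ t) * ‖x‖) ^ 2 := by
  set I := Finset.univ.filter (fun b : Fin t → m => Function.Injective b) with hI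
  set c : Equiv.Perm (Fin t) → ℂ := fun π => (permSlice x b₀ π).trace with hc
  -- These coefficients make the injective part of `⟪z, x⟫` equal to the quantity `S` to be bounded.
  set z := ∑ σ, c σ • permOp (n × m) σ with hz
  have hzinv : z ∈ invariants (n × m) t :=
    Submodule.sum_mem _ fun σ _ => Submodule.smul_mem _ _ (permOp_mem_invariants σ)
  have hz2 : z ∈ innerInvariants n m t := invariants_le_innerInvariants hzinv
  have hε0 := collisionBound_nonneg t d
  set S := I.card * ∑ π, ‖c π‖ ^ 2 with hS
  have hS0 : 0 ≤ S := by positivity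
  have horth : (inner ℂ z x : ℂ) = 0 := (Submodule.mem_orthogonal _ _).1 hx2 z hzinv
  have hDt : (0 : ℝ) ≤ (D : ℝ) ^ t := by positivity
  -- As `⟪z, x⟫ = 0`, `S` is minus the contribution of the colliding rows.
  have h1 : S ≤ collisionBound t d * ‖z‖ * ‖x‖ := by
    have h := inner_eq_card_mul_sum_add hx hz2 hb₀
    rw [horth] at h
    have h2 : ∀ π, (inner ℂ (permSlice z b₀ π) (permSlice x b₀ π) : ℂ) = ((‖c π‖ ^ 2 : ℝ) : ℂ) := by
      intro π
      rw [hz, permSlice_sum_permOp c hb₀, inner_smul_left, frobenius_inner_eq_trace,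
        Matrix.conjTranspose_one, Matrix.one_mul, Complex.conj_mul']
      push_cast
      rfl
    simp only [h2] at h
    have h3 := norm_sum_not_injective_le hx hz2
      (fun b b' => (inner ℂ (outerSlice z b b') (outerSlice x b b') : ℂ))
      (fun b b' => norm_inner_le_norm _ _)
    rw [hd] at h3
    refine le_trans (le_of_eq ?_) h3
    have h4 : (S : ℂ) = -∑ b ∈ Finset.univ.filter (fun b : Fin t → m => ¬ Function.Injective b),
        ∑ b', (inner ℂ (outerSlice z b b') (outerSlice x b b') : ℂ) := by
      rw [eq_neg_iff_add_eq_zero, h, hS]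
      push_cast
      rfl
    rw [← norm_neg, ← h4, Complex.norm_real, Real.norm_of_nonneg hS0]
  -- The colliding rows of `z` hold at most half of `‖z‖²`, which is absorbed on the left.
  have h2 : ‖z‖ ^ 2 ≤ 2 * (D : ℝ) ^ t * S := by
    have h := norm_sq_le_card_mul_sum_add hz2 hb₀
    have h3 : ∀ π, ‖permSlice z b₀ π‖ ^ 2 = ‖c π‖ ^ 2 * (D : ℝ) ^ t := by
      intro π
      rw [hz, permSlice_sum_permOp c hb₀, norm_smul, mul_pow, frobenius_norm_one_sq,
        Fintype.card_fun, Fintype.card_fin, hD]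
      push_cast
      rfl
    simp only [h3, ← Finset.sum_mul] at h
    rw [hd] at h
    have h4 : collisionBound t d * ‖z‖ ^ 2 ≤ 1 / 2 * ‖z‖ ^ 2 := by gcongr
    have h5 : ‖z‖ ^ 2 ≤ S * (D : ℝ) ^ t + collisionBound t d * ‖z‖ ^ 2 := by
      rw [hS, mul_assoc]
      exact h
    linarith
  have h3 : S ^ 2 ≤ S * (2 * collisionBound t d ^ 2 * (D : ℝ) ^ t * ‖x‖ ^ 2) := by
    calc S ^ 2 ≤ (collisionBound t d * ‖z‖ * ‖x‖) ^ 2 := by gcongr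
      _ = collisionBound t d ^ 2 * ‖z‖ ^ 2 * ‖x‖ ^ 2 := by ring
      _ ≤ collisionBound t d ^ 2 * (2 * (D : ℝ) ^ t * S) * ‖x‖ ^ 2 := by gcongr
      _ = _ := by ring
  -- The argument gives the constant `2`; it is relaxed to `4` so that the bound is a square.
  have h4 : (2 * collisionBound t d * Real.sqrt ((D : ℝ) ^ t) * ‖x‖) ^ 2 =
      4 * collisionBound t d ^ 2 * (D : ℝ) ^ t * ‖x‖ ^ 2 := by
    rw [mul_pow, mul_pow, mul_pow, Real.sq_sqrt hDt]
    ring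
  rw [h4]
  rcases hS0.eq_or_lt with h0 | h0
  · rw [← h0]
    positivity
  · rw [sq] at h3
    have h5 := le_of_mul_le_mul_left h3 h0
    have h6 : 0 ≤ collisionBound t d ^ 2 * (D : ℝ) ^ t * ‖x‖ ^ 2 := by positivity
    linarith

/-- The unitary `Ġ`. -/
def dotUnitary (U : m → Matrix.unitaryGroup n ℂ) (inv : Equiv.Perm m) :
    Matrix.unitaryGroup (n × m) ℂ := ⟨dotMatrix U inv, dotMatrix_mem U inv⟩

theorem outerSlice_tensorConj_dotUnitary (U : m → Matrix.unitaryGroup n ℂ) (inv : Equiv.Perm m)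
    (x : Matrix (Fin t → n × m) (Fin t → n × m) ℂ) (b b' : Fin t → m) :
    outerSlice (tensorConj t (dotUnitary U inv) x) (inv ∘ b) (inv ∘ b') =
      tensorFamily U b * outerSlice x b b' * (tensorFamily U b').conjTranspose := by
  ext a a'
  have h1 : ∀ (a α : Fin t → n) (b β : Fin t → m),
      ∏ r, (dotUnitary U inv : Matrix (n × m) (n × m) ℂ) (a r, inv (b r)) (α r, β r) =
        if b = β then ∏ r, (U (b r) : Matrix n n ℂ) (a r) (α r) else 0 := fun a α b β => by
    simp only [dotUnitary, dotMatrix, Matrix.of_apply, EmbeddingLike.apply_eq_iff_eq,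
      Finset.prod_ite_zero, Finset.mem_univ, forall_const, ← funext_iff]
    split_ifs with h
    · rw [h]
    · rfl
  rw [tensorFamily_conj_apply, outerSlice, Matrix.of_apply, tensorConj_apply]
  simp only [sum_pair, ← map_prod, Function.comp_apply, h1, outerSlice, Matrix.of_apply]
  refine Finset.sum_congr rfl fun α _ => ?_
  rw [Finset.sum_eq_single b]
  · refine Finset.sum_congr rfl fun α' _ => ?_
    rw [Finset.sum_eq_single b']
    · simp
    · intro β' _ h
      simp [h.symm]
    · simp
  · intro β _ h
    simp [h.symm]
  · simp

/-- The relabelling `b ↦ -b` of the second register is absorbed by the invariance of `y` under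
permutation matrices. -/
theorem inner_tensorConj_dotUnitary (U : m → Matrix.unitaryGroup n ℂ) (inv : Equiv.Perm m)
    {y : Matrix (Fin t → n × m) (Fin t → n × m) ℂ} (hy : y ∈ innerInvariants n m t)
    (x : Matrix (Fin t → n × m) (Fin t → n × m) ℂ) :
    (inner ℂ y (tensorConj t (dotUnitary U inv) x) : ℂ) = ∑ b, ∑ b', inner ℂ (outerSlice y b b')
      (tensorFamily U b * outerSlice x b b' * (tensorFamily U b').conjTranspose) := by
  let e : (Fin t → m) ≃ (Fin t → m) := (Equiv.refl _).arrowCongr inv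
  have he : ∀ b, e b = inv ∘ b := fun b => rfl
  rw [inner_eq_sum_outerSlice, ← e.sum_comp]
  refine Finset.sum_congr rfl fun b _ => ?_
  rw [← e.sum_comp]
  refine Finset.sum_congr rfl fun b' _ => ?_
  rw [he, he, outerSlice_tensorConj_dotUnitary, outerSlice_perm hy]

/-- Undoing `π` on the column side turns the mixed factors `U_b`, `U_{b ∘ π}` into conjugation by
the single unitary `U_b`, to which the expander bound applies. This is the reason for the definition
of `permSlice`. -/
theorem inner_outerSlice_comp_perm {m : Type*} (U : m → Matrix.unitaryGroup n ℂ)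
    (y x : Matrix (Fin t → n × m) (Fin t → n × m) ℂ) (b : Fin t → m) (π : Equiv.Perm (Fin t)) :
    (inner ℂ (outerSlice y b (b ∘ π)) (tensorFamily U b * outerSlice x b (b ∘ π) *
      (tensorFamily U (b ∘ π)).conjTranspose) : ℂ) =
    inner ℂ (permSlice y b π)
      (tensorFamily U b * permSlice x b π * (tensorFamily U b).conjTranspose) := by
  let e : (Fin t → n) ≃ (Fin t → n) := π.symm.arrowCongr (Equiv.refl n)
  have h1 : (tensorFamily U (b ∘ π)).submatrix e e = tensorFamily U b := by
    ext i j
    exact Equiv.prod_comp π fun r => (U (b r) : Matrix n n ℂ) (i r) (j r)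
  have h2 : (tensorFamily U b * outerSlice x b (b ∘ π) *
      (tensorFamily U (b ∘ π)).conjTranspose).submatrix (Equiv.refl _) e =
      tensorFamily U b * permSlice x b π * (tensorFamily U b).conjTranspose := by
    rw [← h1, Matrix.conjTranspose_submatrix, permSlice,
      ← Matrix.submatrix_mul_equiv _ _ _ e, ← Matrix.submatrix_mul_equiv _ _ _ (Equiv.refl _), h1]
    rfl
  rw [← h2, permSlice]
  exact (inner_submatrix _ _ _ _).symm

/-- Writing `ε` for the collision bound, the excess `5ε` consists of `2ε` for restricting the
average to injective tuples, `2ε` for the traces, which orthogonality to permutations makes small,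
and `ε` for the colliding rows. -/
theorem IsQTPE.norm_inner_tensorConj_dotUnitary_le [Nonempty n] {D d : ℕ} {lam : ℝ}
    {U : m → Matrix.unitaryGroup n ℂ} (hU : IsQTPE D d lam 1 U) (inv : Equiv.Perm m)
    (hε : collisionBound t d ≤ 1 / 2) (htd : t ≤ d)
    {x y : Matrix (Fin t → n × m) (Fin t → n × m) ℂ} (hx : x ∈ innerInvariants n m t)
    (hy : y ∈ innerInvariants n m t) (hx2 : x ∈ (invariants (n × m) t)ᗮ) :
    ‖(inner ℂ y (tensorConj t (dotUnitary U inv) x) : ℂ)‖ ≤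
      (lam + 5 * collisionBound t d) * ‖y‖ * ‖x‖ := by
  classical
  have := hU.nonempty
  have hlam := hU.nonneg
  have hε0 := collisionBound_nonneg t d
  set ε := collisionBound t d with hεdef
  obtain ⟨b₀, hb₀⟩ : ∃ b₀ : Fin t → m, Function.Injective b₀ := by
    obtain ⟨e⟩ := Function.Embedding.nonempty_of_card_le (α := Fin t) (β := m)
      (by rw [Fintype.card_fin, hU.card_degree]; exact htd)
    exact ⟨e, e.injective⟩
  set I := Finset.univ.filter (fun b : Fin t → m => Function.Injective b) with hI
  have hDt : 0 < Real.sqrt ((D : ℝ) ^ t) := by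
    refine Real.sqrt_pos.2 (pow_pos ?_ t)
    rw [← hU.card_dim]
    exact_mod_cast Fintype.card_pos
  have htr := card_mul_sum_norm_trace_sq_le hU.card_dim hU.card_degree hε hx hx2 hb₀
  have hX := card_mul_sum_norm_permSlice_le hx hb₀
  have hY := card_mul_sum_norm_permSlice_le hy hb₀
  rw [← hI] at htr hX hY
  -- Cauchy–Schwarz over the permutations, with weight `|I|`, so that no factor `t!` appears.
  have hcs : ∀ f g : Equiv.Perm (Fin t) → ℝ, ∀ A B : ℝ, 0 ≤ A → 0 ≤ B →
      I.card * ∑ π, f π ^ 2 ≤ A ^ 2 → I.card * ∑ π, g π ^ 2 ≤ B ^ 2 →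
      I.card * ∑ π, f π * g π ≤ A * B := by
    intro f g A B hA hB hf hg
    calc I.card * ∑ π, f π * g π
        ≤ I.card * (Real.sqrt (∑ π, f π ^ 2) * Real.sqrt (∑ π, g π ^ 2)) := by
          gcongr
          exact Real.sum_mul_le_sqrt_mul_sqrt _ _ _
      _ = Real.sqrt (I.card * ∑ π, f π ^ 2) * Real.sqrt (I.card * ∑ π, g π ^ 2) := by
          rw [Real.sqrt_mul (Nat.cast_nonneg _), Real.sqrt_mul (Nat.cast_nonneg _)]
          have := Real.mul_self_sqrt (Nat.cast_nonneg (α := ℝ) I.card)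
          linear_combination (-(Real.sqrt (∑ π, f π ^ 2) * Real.sqrt (∑ π, g π ^ 2))) * this
      _ ≤ Real.sqrt (A ^ 2) * Real.sqrt (B ^ 2) := by gcongr
      _ = A * B := by rw [Real.sqrt_sq hA, Real.sqrt_sq hB]
  have h1 := hcs (fun π => ‖permSlice x b₀ π‖) (fun π => ‖permSlice y b₀ π‖) ‖x‖ ‖y‖
    (norm_nonneg _) (norm_nonneg _) hX hY
  have h2 := hcs (fun π => ‖(permSlice x b₀ π).trace‖) (fun π => ‖permSlice y b₀ π‖)
    (2 * ε * Real.sqrt ((D : ℝ) ^ t) * ‖x‖) ‖y‖ (by positivity) (norm_nonneg _) htr hY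
  rw [inner_tensorConj_dotUnitary U inv hy, sum_split hx _ fun b b' h => by
    rw [h, Matrix.mul_zero, Matrix.zero_mul, inner_zero_right]]
  refine (norm_add_le _ _).trans ?_
  have hnon := norm_sum_not_injective_le hx hy
    (fun b b' => (inner ℂ (outerSlice y b b')
      (tensorFamily U b * outerSlice x b b' * (tensorFamily U b').conjTranspose) : ℂ))
    (fun b b' => (norm_inner_le_norm _ _).trans (by rw [norm_tensorFamily_conj]))
  rw [hU.card_degree] at hnon
  have hinj : ‖∑ b ∈ I, ∑ π : Equiv.Perm (Fin t), (inner ℂ (outerSlice y b (b ∘ π))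
      (tensorFamily U b * outerSlice x b (b ∘ π) *
        (tensorFamily U (b ∘ π)).conjTranspose) : ℂ)‖ ≤ (lam + 4 * ε) * ‖y‖ * ‖x‖ := by
    have h3 : ∑ b ∈ I, ∑ π : Equiv.Perm (Fin t), (inner ℂ (outerSlice y b (b ∘ π))
        (tensorFamily U b * outerSlice x b (b ∘ π) *
          (tensorFamily U (b ∘ π)).conjTranspose) : ℂ) =
        ∑ π : Equiv.Perm (Fin t), ∑ b ∈ I, (inner ℂ (permSlice y b₀ π)
          (tensorFamily U b * permSlice x b₀ π * (tensorFamily U b).conjTranspose) : ℂ) := by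
      rw [Finset.sum_comm]
      refine Finset.sum_congr rfl fun π _ => Finset.sum_congr rfl fun b hb => ?_
      have hb := (Finset.mem_filter.1 hb).2
      rw [inner_outerSlice_comp_perm, permSlice_eq hx hb₀ hb, permSlice_eq hy hb₀ hb]
    rw [h3]
    calc _ ≤ ∑ π : Equiv.Perm (Fin t), (I.card : ℝ) *
          ((lam + 2 * ε) * ‖permSlice x b₀ π‖ * ‖permSlice y b₀ π‖ +
            ‖(permSlice x b₀ π).trace‖ / Real.sqrt ((D : ℝ) ^ t) * ‖permSlice y b₀ π‖) :=
          (norm_sum_le _ _).trans (Finset.sum_le_sum fun π _ => hU.norm_sum_injective_conj_le _ _)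
      _ = (lam + 2 * ε) * (I.card * ∑ π, ‖permSlice x b₀ π‖ * ‖permSlice y b₀ π‖) +
          (Real.sqrt ((D : ℝ) ^ t))⁻¹ *
            (I.card * ∑ π, ‖(permSlice x b₀ π).trace‖ * ‖permSlice y b₀ π‖) := by
          simp only [Finset.mul_sum, ← Finset.sum_add_distrib]
          refine Finset.sum_congr rfl fun π _ => ?_
          rw [div_eq_mul_inv]
          ring
      _ ≤ (lam + 2 * ε) * (‖x‖ * ‖y‖) + (Real.sqrt ((D : ℝ) ^ t))⁻¹ *
            (2 * ε * Real.sqrt ((D : ℝ) ^ t) * ‖x‖ * ‖y‖) := by gcongr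
      _ = _ := by
          field_simp
          ring
  calc _ ≤ (lam + 4 * ε) * ‖y‖ * ‖x‖ + ε * ‖y‖ * ‖x‖ := add_le_add hinj hnon
    _ = _ := by ring

end DotEstimate

/-- The zigzag argument: `E` is the identity on `Q` and contracts `Qᗮ` by `μ`, and the compression
of `G` to `Q`, away from the common fixed vectors `K`, has norm at most `p`. -/
theorem norm_zigzag_sub_starProjection_le {H : Type*} [NormedAddCommGroup H]
    [InnerProductSpace ℂ H] {K Q : Submodule ℂ H} [K.HasOrthogonalProjection]
    [Q.HasOrthogonalProjection] (hKQ : K ≤ Q) {E G : H →ₗ[ℂ] H} {p μ : ℝ} (hp : 0 ≤ p)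
    (hμ : 0 ≤ μ) (hEQ : ∀ x ∈ Q, E x = x) (hEQ' : ∀ x ∈ Qᗮ, E x ∈ Qᗮ)
    (hE : ∀ x ∈ Qᗮ, ‖E x‖ ≤ μ * ‖x‖) (hGK : ∀ x ∈ K, G x = x) (hG : ∀ x, ‖G x‖ = ‖x‖)
    (hp' : ∀ x ∈ Q, ∀ y ∈ Q, x ∈ Kᗮ → ‖(inner ℂ y (G x) : ℂ)‖ ≤ p * ‖y‖ * ‖x‖) (x : H) :
    ‖E (G (E x)) - K.starProjection x‖ ≤ (p + μ + μ ^ 2) * ‖x‖ := by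
  have hdec : ∀ z : H, ∃ z₀ ∈ Q, ∃ z₁ ∈ Qᗮ, z = z₀ + z₁ ∧ ‖z‖ ^ 2 = ‖z₀‖ ^ 2 + ‖z₁‖ ^ 2 := by
    intro z
    refine ⟨Q.starProjection z, Q.starProjection_apply_mem z, z - Q.starProjection z,
      Q.sub_starProjection_mem_orthogonal z, (add_sub_cancel _ _).symm, ?_⟩
    have h := norm_add_sq_eq_norm_sq_add_norm_sq_of_inner_eq_zero (𝕜 := ℂ) (Q.starProjection z)
      (z - Q.starProjection z) ((Submodule.mem_orthogonal _ _).1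
        (Q.sub_starProjection_mem_orthogonal z) _ (Q.starProjection_apply_mem z))
    rw [add_sub_cancel] at h
    simpa only [sq] using h
  have key : ∀ x ∈ Kᗮ, ∀ y : H,
      ‖(inner ℂ y (E (G (E x))) : ℂ)‖ ≤ (p + μ + μ ^ 2) * ‖y‖ * ‖x‖ := by
    intro x hx y
    obtain ⟨x₀, hx₀, x₁, hx₁, rfl, hxn⟩ := hdec x
    obtain ⟨y₀, hy₀, y₁, hy₁, rfl, hyn⟩ := hdec y
    have hx₀K : x₀ ∈ Kᗮ := by
      have h : x₁ ∈ Kᗮ := Submodule.orthogonal_le hKQ hx₁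
      simpa using Submodule.sub_mem _ hx h
    -- Since `E` preserves both `Q` and `Qᗮ`, a vector of `Qᗮ` sees only the contracted component;
    -- no adjoint of `E` is needed.
    have hbil : ∀ u : H, ∀ c : ℝ, ‖u‖ ≤ c → ‖(inner ℂ y₁ (E u) : ℂ)‖ ≤ μ * ‖y₁‖ * c := by
      intro u c hu
      obtain ⟨u₀, hu₀, u₁, hu₁, rfl, hun⟩ := hdec u
      have h0 : (inner ℂ y₁ u₀ : ℂ) = 0 := (Submodule.mem_orthogonal' _ _).1 hy₁ _ hu₀
      rw [map_add, hEQ _ hu₀, inner_add_right, h0, zero_add]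
      have h1 : ‖u₁‖ ≤ c := by
        refine le_trans (le_of_sq_le_sq ?_ (norm_nonneg _)) hu
        rw [hun]
        exact le_add_of_nonneg_left (sq_nonneg _)
      calc _ ≤ ‖y₁‖ * ‖E u₁‖ := norm_inner_le_norm _ _
        _ ≤ ‖y₁‖ * (μ * c) := by
          gcongr
          exact (hE _ hu₁).trans (by gcongr)
        _ = _ := by ring
    have hbil₀ : ∀ u : H, (inner ℂ y₀ (E u) : ℂ) = inner ℂ y₀ u := by
      intro u
      obtain ⟨u₀, hu₀, u₁, hu₁, rfl, -⟩ := hdec u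
      rw [map_add, hEQ _ hu₀, inner_add_right, inner_add_right,
        (Submodule.mem_orthogonal _ _).1 hu₁ _ hy₀,
        (Submodule.mem_orthogonal _ _).1 (hEQ' _ hu₁) _ hy₀]
    have hterm : (inner ℂ (y₀ + y₁) (E (G (E (x₀ + x₁)))) : ℂ) = inner ℂ y₀ (G x₀) +
        inner ℂ y₀ (G (E x₁)) + inner ℂ y₁ (E (G x₀)) + inner ℂ y₁ (E (G (E x₁))) := by
      rw [inner_add_left, hbil₀, map_add E, hEQ _ hx₀, map_add, map_add, inner_add_right,
        inner_add_right]
      ring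
    have h1 := hp' x₀ hx₀ y₀ hy₀ hx₀K
    have h2 : ‖(inner ℂ y₀ (G (E x₁)) : ℂ)‖ ≤ μ * ‖y₀‖ * ‖x₁‖ := by
      refine (norm_inner_le_norm _ _).trans ?_
      rw [hG]
      calc _ ≤ ‖y₀‖ * (μ * ‖x₁‖) := by
            gcongr
            exact hE _ hx₁
        _ = _ := by ring
    have h3 := hbil (G x₀) ‖x₀‖ (hG _).le
    have h4 := hbil (G (E x₁)) (μ * ‖x₁‖) (by rw [hG]; exact hE _ hx₁)
    -- Cauchy–Schwarz in the plane. It bounds the two cross terms together, so that they cost `μ`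
    -- and not `2μ`.
    have hle : ∀ a b c d A B : ℝ, 0 ≤ A → 0 ≤ B → A ^ 2 = a ^ 2 + b ^ 2 → B ^ 2 = c ^ 2 + d ^ 2 →
        a * c + b * d ≤ A * B := by
      intro a b c d A B hA hB h h'
      refine le_of_sq_le_sq ?_ (mul_nonneg hA hB)
      rw [mul_pow, h, h']
      nlinarith [sq_nonneg (a * d - b * c)]
    have hy₀le : ‖y₀‖ * ‖x₀‖ ≤ ‖y₀ + y₁‖ * ‖x₀ + x₁‖ := by
      have := hle ‖y₀‖ ‖y₁‖ ‖x₀‖ ‖x₁‖ _ _ (norm_nonneg _) (norm_nonneg _) hyn hxn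
      have h0 : 0 ≤ ‖y₁‖ * ‖x₁‖ := by positivity
      linarith
    have hy₁le : ‖y₁‖ * ‖x₁‖ ≤ ‖y₀ + y₁‖ * ‖x₀ + x₁‖ := by
      have := hle ‖y₀‖ ‖y₁‖ ‖x₀‖ ‖x₁‖ _ _ (norm_nonneg _) (norm_nonneg _) hyn hxn
      have h0 : 0 ≤ ‖y₀‖ * ‖x₀‖ := by positivity
      linarith
    have hcross : ‖y₀‖ * ‖x₁‖ + ‖y₁‖ * ‖x₀‖ ≤ ‖y₀ + y₁‖ * ‖x₀ + x₁‖ :=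
      hle _ _ _ _ _ _ (norm_nonneg _) (norm_nonneg _) hyn (by rw [hxn, add_comm])
    rw [hterm]
    calc _ ≤ p * ‖y₀‖ * ‖x₀‖ + μ * ‖y₀‖ * ‖x₁‖ + μ * ‖y₁‖ * ‖x₀‖ + μ * ‖y₁‖ * (μ * ‖x₁‖) :=
          norm_add₄_le.trans (by gcongr)
      _ = p * (‖y₀‖ * ‖x₀‖) + μ * (‖y₀‖ * ‖x₁‖ + ‖y₁‖ * ‖x₀‖) + μ ^ 2 * (‖y₁‖ * ‖x₁‖) := by ring
      _ ≤ p * (‖y₀ + y₁‖ * ‖x₀ + x₁‖) + μ * (‖y₀ + y₁‖ * ‖x₀ + x₁‖) +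
          μ ^ 2 * (‖y₀ + y₁‖ * ‖x₀ + x₁‖) := by gcongr
      _ = _ := by ring
  set k := K.starProjection x with hk
  have hkK : k ∈ K := K.starProjection_apply_mem x
  have hkE : E k = k := hEQ _ (hKQ hkK)
  have hsub : E (G (E x)) - k = E (G (E (x - k))) := by
    rw [map_sub, map_sub, map_sub, hkE, hGK _ hkK, hkE]
  have hxk : x - k ∈ Kᗮ := K.sub_starProjection_mem_orthogonal x
  have hxkn : ‖x - k‖ ≤ ‖x‖ := by
    have h := norm_add_sq_eq_norm_sq_add_norm_sq_of_inner_eq_zero (𝕜 := ℂ) k (x - k)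
      ((Submodule.mem_orthogonal _ _).1 hxk _ hkK)
    rw [add_sub_cancel] at h
    nlinarith [norm_nonneg x, norm_nonneg k, norm_nonneg (x - k)]
  -- Testing the bilinear bound against the output `w` itself recovers its norm.
  set w := E (G (E (x - k))) with hw
  have h := key (x - k) hxk w
  rw [← hw, inner_self_eq_norm_sq_to_K] at h
  have h2 : ‖w‖ * ‖w‖ ≤ ((p + μ + μ ^ 2) * ‖x‖) * ‖w‖ := by
    have h3 : ‖((‖w‖ : ℂ)) ^ 2‖ = ‖w‖ * ‖w‖ := by
      rw [norm_pow, Complex.norm_real, norm_norm, sq]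
    calc ‖w‖ * ‖w‖ ≤ (p + μ + μ ^ 2) * ‖w‖ * ‖x - k‖ := h3 ▸ h
      _ ≤ (p + μ + μ ^ 2) * ‖w‖ * ‖x‖ := by gcongr
      _ = _ := by ring
  rw [hsub]
  rcases (norm_nonneg w).eq_or_lt with h0 | h0
  · rw [← h0]
    positivity
  · exact le_of_mul_le_mul_right h2 h0

/-! ### The zigzag product as an expander -/

section Assembly

attribute [local instance] Matrix.frobeniusNormedAddCommGroup Matrix.frobeniusNormedSpace
  frobeniusInnerProductSpace

variable {n m κ : Type*} [Fintype n] [DecidableEq n] [Fintype m] [DecidableEq m] [Fintype κ]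
  {t : ℕ}

/-- `designAvg t U` as a linear map. -/
noncomputable def designAvgₗ (t : ℕ) (U : κ → Matrix.unitaryGroup n ℂ) :
    Matrix (Fin t → n) (Fin t → n) ℂ →ₗ[ℂ] Matrix (Fin t → n) (Fin t → n) ℂ :=
  (Fintype.card κ : ℂ)⁻¹ • ∑ i, tensorConjₗ t (U i)

theorem designAvgₗ_apply (U : κ → Matrix.unitaryGroup n ℂ)
    (M : Matrix (Fin t → n) (Fin t → n) ℂ) : designAvgₗ t U M = designAvg t U M := by
  simp [designAvgₗ, designAvg, tensorConjₗ_apply]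

theorem innerSlice_designAvg (V : κ → Matrix.unitaryGroup m ℂ)
    (x : Matrix (Fin t → n × m) (Fin t → n × m) ℂ) (a a' : Fin t → n) :
    innerSlice (designAvg t (fun i => innerUnitary n (V i)) x) a a' =
      designAvg t V (innerSlice x a a') := by
  have h : ∀ i, tensorConj t (V i) (innerSlice x a a') =
      innerSlice (tensorConj t (innerUnitary n (V i)) x) a a' := fun i =>
    (innerSlice_tensorConj_innerUnitary _ _ _ _).symm
  unfold designAvg
  simp only [h]
  ext b b'
  simp [innerSlice, Matrix.sum_apply]

/-- The indices `i` and `j` are averaged independently, so the twirl factors as `E ∘ G ∘ E`. -/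
theorem designAvg_zigzag (U : m → Matrix.unitaryGroup n ℂ) (inv : Equiv.Perm m)
    (V : κ → Matrix.unitaryGroup m ℂ) (x : Matrix (Fin t → n × m) (Fin t → n × m) ℂ) :
    designAvg t (zigzag U inv V) x = designAvg t (fun i => innerUnitary n (V i))
      (tensorConj t (dotUnitary U inv) (designAvg t (fun i => innerUnitary n (V i)) x)) := by
  have h : ∀ p, zigzag U inv V p =
      innerUnitary n (V p.1) * dotUnitary U inv * innerUnitary n (V p.2) := fun p => rfl
  have hmul' : ∀ A B C : Matrix.unitaryGroup (n × m) ℂ, tensorConjₗ t (A * B * C) x =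
      tensorConjₗ t A (tensorConjₗ t B (tensorConjₗ t C x)) := fun A B C => by
    simp only [tensorConjₗ_apply, tensorConj_mul]
  rw [← tensorConjₗ_apply]
  unfold designAvg
  simp only [h, hmul', map_smul, map_sum, ← tensorConjₗ_apply, Fintype.card_prod,
    Fintype.sum_prod_type, Finset.smul_sum, smul_smul, Nat.cast_mul, mul_inv]

theorem IsQTPE.norm_designAvg_le_of_haarAvg_eq_zero {d s : ℕ} {lam : ℝ}
    {V : κ → Matrix.unitaryGroup m ℂ} (hV : IsQTPE d s lam t V)
    {M : Matrix (Fin t → m) (Fin t → m) ℂ} (hM : haarAvg t M = 0) :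
    ‖designAvg t V M‖ ≤ lam * ‖M‖ := by
  have h := hV.norm_le M
  rwa [hM, sub_zero] at h

theorem haarAvg_innerSlice_eq_zero {x : Matrix (Fin t → n × m) (Fin t → n × m) ℂ}
    (hx : x ∈ (innerInvariants n m t)ᗮ) (a a' : Fin t → n) :
    haarAvg t (innerSlice x a a') = 0 := by
  set Z := haarAvg t (innerSlice x a a') with hZ
  -- The test operator carries `Z` in the single block `(a, a')`; orthogonality of `x` to it gives
  -- `⟪Z, Z⟫ = 0`.
  let z : Matrix (Fin t → n × m) (Fin t → n × m) ℂ := Matrix.of fun i j =>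
    if (fun r => (i r).1) = a ∧ (fun r => (j r).1) = a' then
      Z (fun r => (i r).2) (fun r => (j r).2) else 0
  have hzs : ∀ c c', innerSlice z c c' = if c = a ∧ c' = a' then Z else 0 := by
    intro c c'
    ext b b'
    simp only [innerSlice, z, Matrix.of_apply]
    split_ifs <;> rfl
  have hz : z ∈ innerInvariants n m t := by
    intro c c'
    rw [hzs]
    split_ifs
    · exact haarAvg_mem_invariants _
    · exact Submodule.zero_mem _
  have h := (Submodule.mem_orthogonal _ _).1 hx z hz
  rw [inner_eq_sum_innerSlice, Finset.sum_eq_single a, Finset.sum_eq_single a', hzs,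
    if_pos ⟨rfl, rfl⟩, ← inner_haarAvg (haarAvg_mem_invariants _)] at h
  · exact inner_self_eq_zero.1 h
  · intro c' _ hc
    rw [hzs, if_neg (fun e => hc e.2), inner_zero_left]
  · simp
  · intro c _ hc
    refine Finset.sum_eq_zero fun c' _ => ?_
    rw [hzs, if_neg (fun e => hc e.1), inner_zero_left]
  · simp

/-- The zigzag argument with `p = lam₁ + 5ε` and `μ = lam₂`, where `ε` is the collision bound: a
linear error term in place of a fourth root. -/
theorem IsQTPE.zigzag_isQTPE [Nonempty n] {D d s : ℕ} {lam₁ lam₂ : ℝ}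
    {U : m → Matrix.unitaryGroup n ℂ} {V : κ → Matrix.unitaryGroup m ℂ}
    (hU : IsQTPE D d lam₁ 1 U) (hV : IsQTPE d s lam₂ t V) (inv : Equiv.Perm m)
    (hε : collisionBound t d ≤ 1 / 2) (htd : t ≤ d) :
    IsQTPE (D * d) (s ^ 2) (lam₁ + 5 * collisionBound t d + lam₂ + lam₂ ^ 2) t
      (zigzag U inv V) where
  card_dim := by rw [Fintype.card_prod, hU.card_dim, hU.card_degree]
  card_degree := by rw [Fintype.card_prod, hV.card_degree, sq]
  degree_pos := pow_pos hV.degree_pos 2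
  norm_le x := by
    have := hU.nonempty
    have := hV.nonempty
    have hε0 := collisionBound_nonneg t d
    have hlam₁ := hU.nonneg
    have hlam₂ := hV.nonneg
    rw [designAvg_zigzag, haarAvg_eq_starProjection, ← designAvgₗ_apply, ← designAvgₗ_apply,
      ← tensorConjₗ_apply]
    refine norm_zigzag_sub_starProjection_le invariants_le_innerInvariants (by positivity) hlam₂
      ?_ ?_ ?_ ?_ ?_ ?_ x
    · intro x hx
      rw [designAvgₗ_apply]
      ext i j
      have h := innerSlice_designAvg V x (fun r => (i r).1) (fun r => (j r).1)
      rw [designAvg_of_mem_invariants V (hx _ _)] at h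
      exact congrFun (congrFun h fun r => (i r).2) fun r => (j r).2
    · intro x hx
      rw [Submodule.mem_orthogonal]
      intro z hz
      rw [designAvgₗ_apply, ← (Submodule.mem_orthogonal _ _).1 hx z hz, inner_eq_sum_innerSlice,
        inner_eq_sum_innerSlice]
      refine Finset.sum_congr rfl fun a _ => Finset.sum_congr rfl fun a' _ => ?_
      rw [innerSlice_designAvg, inner_designAvg V (hz a a')]
    · intro x hx
      refine le_of_sq_le_sq ?_ (by positivity)
      rw [designAvgₗ_apply, mul_pow, norm_sq_eq_sum_innerSlice, norm_sq_eq_sum_innerSlice x,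
        Finset.mul_sum]
      refine Finset.sum_le_sum fun a _ => ?_
      rw [Finset.mul_sum]
      refine Finset.sum_le_sum fun a' _ => ?_
      rw [innerSlice_designAvg, ← mul_pow]
      gcongr
      exact hV.norm_designAvg_le_of_haarAvg_eq_zero (haarAvg_innerSlice_eq_zero hx a a')
    · exact fun x hx => hx _
    · exact fun x => norm_tensorConj _ x
    · exact fun x hx y hy hx2 => hU.norm_inner_tensorConj_dotUnitary_le inv hε htd hx hy hx2

end Assembly

theorem IsQTPE.mono {n κ : Type*} [Fintype n] [DecidableEq n] [Fintype κ] {d s t : ℕ}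
    {lam lam' : ℝ} {U : κ → Matrix.unitaryGroup n ℂ} (hU : IsQTPE d s lam t U) (h : lam ≤ lam') :
    IsQTPE d s lam' t U :=
  ⟨hU.card_dim, hU.card_degree, hU.degree_pos, fun M => (hU.norm_le M).trans
    (mul_le_mul_of_nonneg_right h (by rw [hsNorm_eq]; exact Real.sqrt_nonneg _))⟩

end ZigzagTPE

theorem mainTheorem1 (D d s t : ℕ) (ht : 1 ≤ t) (lam₁ lam₂ : ℝ)
    (U : Fin d → Matrix.unitaryGroup (Fin D) ℂ) (V : Fin s → Matrix.unitaryGroup (Fin d) ℂ)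
    (inv : Equiv.Perm (Fin d))
    (hinv : ZigzagTPE.IsHermitianInvolution U inv ∨ inv = Equiv.refl (Fin d))
    (hU : ZigzagTPE.IsQTPE D d lam₁ 1 U) (hV : ZigzagTPE.IsQTPE d s lam₂ t V)
    (hD : d ≤ D) (hd : 10 * t ^ 2 ≤ d) :
    ZigzagTPE.IsQTPE (D * d) (s ^ 2)
      (lam₁ + lam₂ + lam₂ ^ 2 + 24 * ((t : ℝ) * ((t : ℝ) - 1) / (d : ℝ)) ^ (1 / 4 : ℝ)) t
      (ZigzagTPE.zigzag U inv V) := by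
  have hdpos : 0 < d := lt_of_lt_of_le (by positivity) hd
  have : Nonempty (Fin D) := ⟨⟨0, lt_of_lt_of_le hdpos hD⟩⟩
  have hdr : (10 : ℝ) * t ^ 2 ≤ d := by exact_mod_cast hd
  have hdr0 : (0 : ℝ) < d := by exact_mod_cast hdpos
  have hε : ZigzagTPE.collisionBound t d ≤ 1 / 2 := by
    rw [ZigzagTPE.collisionBound, div_le_iff₀ hdr0]
    have : (0 : ℝ) ≤ t := Nat.cast_nonneg t
    nlinarith
  have hε0 := ZigzagTPE.collisionBound_nonneg t d
  have htd : t ≤ d := by nlinarith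
  refine (hU.zigzag_isQTPE hV inv hε htd).mono ?_
  -- On `[0, 1]` a number is at most its fourth root, and `5 ≤ 24` does the rest.
  have hpow : ZigzagTPE.collisionBound t d ≤ ZigzagTPE.collisionBound t d ^ (1 / 4 : ℝ) := by
    conv_lhs => rw [← Real.rpow_one (ZigzagTPE.collisionBound t d)]
    exact Real.rpow_le_rpow_of_exponent_ge' hε0 (by linarith) (by norm_num) (by norm_num)
  change _ ≤ lam₁ + lam₂ + lam₂ ^ 2 + 24 * ZigzagTPE.collisionBound t d ^ (1 / 4 : ℝ)
  linarith
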